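/- **Definitions.** Permutations are written as words. An H-pattern is a permutation $\tau\in\mathcal S_k$ with $k\ge 2$. An occurrence of $\tau$ in a permutation $\pi$ is a factor (block of consecutive entries) $b_1\cdots b_k$ of $\pi$ such that $b_i-\tau(i)$ is the same integer for all $i$; if there is one, $\tau$ is an H-pattern of $\pi$. Let $T$ be a set of H-patterns that is *simple* (no element of $T$ is an H-pattern of another one) and *self-inverse* ($\tau\in T$ whenever $\tau^{-1}\in T$). Let $T_I$ be the set of involutions in $T$, and let $T=T_I\,\dot\cup\, T_L\,\dot\cup\, T_L^{-1}$, where $T_L^{-1}=\{\sigma^{-1}:\sigma\in T_L\}$. The *sibling* of an occurrence $\pi_j\cdots\pi_{j+k-1}$ of $\tau$ in an involution $\pi$ is the occurrence of $\tau^{-1}$ in $\pi$ formed by the symbols $j,\ldots,j+k-1$. A *$T$-marked permutation* is a pair $(\pi,M)$ with $M$ a set of occurrences in $\pi$ of patterns from $T$. It is a *$T$-cluster* if $|\pi|\ge 2$ and $\pi$ cannot be cut into two non-empty factors such that each element of $M$ is contained in one of them. An *involutory $T$-cluster* is a $T$-cluster $(\pi,M)$ such that $\pi$ is an involution and $M$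 contains the sibling of each of its elements. Let $x,t$, $u_\tau,\bar u_\tau$ $(\tau\in T_I)$ and $w_\sigma$ $(\sigma\in T_L)$ be variables. Let $\mathrm{fp}$ denote the number of fixed points and $\mathrm{cyc}$ the number of $2$-cycles. Put $$I(t,y)=\sum_{\pi}t^{\mathrm{fp}(\pi)}y^{\mathrm{cyc}(\pi)},$$ $$F_T(x,t,u,\bar u,w)=\sum_{\pi}x^{|\pi|}t^{\mathrm{fp}(\pi)}\prod_{\tau\in T_I}u_\tau^{\tau^{sib}(\pi)}\,\bar u_\tau^{\tau^{nsib}(\pi)}\prod_{\sigma\in T_L}w_\sigma^{\sigma(\pi)},$$ both sums over all involutions of all lengths $n\ge 0$, where $\sigma(\pi)$ is the number of occurrences of $\sigma$ in $\pi$, and $\tau^{sib}(\pi)$, $\tau^{nsib}(\pi)$ are the numbers of occurrences of $\tau$ in $\pi$ that coincide, respectively do not coincide, with their sibling. Put $$C_T(x,a,b,c)=\sum_{(\pi,M)}x^{|\pi|}\prod_{\tau\in T_I}a_\tau^{\tau(\pi,M)}\prod_{\sigma\in T_L}b_\sigma^{\sigma(\pi,M)}c_\sigma^{\sigma^{-1}(\pi,M)}$$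 over all $T$-clusters, and $$CI_T(x,t,u,\bar u,w)=\sum_{(\pi,M)}x^{|\pi|}t^{\mathrm{fp}(\pi)}\prod_{\tau\in T_I}u_\tau^{\tau^{sib}(\pi,M)}\,\bar u_\tau^{\tau^{nsib}(\pi,M)}\prod_{\sigma\in T_L}w_\sigma^{\sigma(\pi,M)}$$ over all involutory $T$-clusters, where the exponents count only the occurrences belonging to $M$. **Theorem.** As formal power series in $x$, $$F_T(x,t,u,\bar u,w)=I\Bigl(xt+CI_T\bigl(x,t,\,u-1,\,\sqrt{\bar u^2-1},\,w-1\bigr),\;x^2+C_T\bigl(x^2,\,\bar u^2-1,\,w-1,\,w-1\bigr)\Bigr),$$ where $u-1$, $\sqrt{\bar u^2-1}$, $\bar u^2-1$, $w-1$ denote the families $(u_\tau-1)_\tau$, $(\sqrt{\bar u_\tau^2-1})_\tau$, $(\bar u_\tau^2-1)_\tau$, $(w_\sigma-1)_\sigma$. The identity holds whenever $t,u_\tau,\bar u_\tau,w_\sigma$ are elements of a commutative ring, for any choice in that ring of square roots of $\bar u_\tau^2-1$; in particular it holds for independent variables, after adjoining the square roots to the polynomial ring. -/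

import Mathlib

open Finset
open scoped Classical

namespace Hertzsprung

/-- A Hertzsprung pattern: a permutation `τ` of `k` objects with `k ≥ 2`. Permutations of length `n`
are elements of `Equiv.Perm (Fin n)`, so that positions and symbols are numbered from `0`. -/
structure HPattern where
  /-- the length `k` of the pattern -/
  size : ℕ
  two_le : 2 ≤ size
  /-- the permutation -/
  perm : Equiv.Perm (Fin size)

/-- The inverse pattern `τ⁻¹`. -/
def HPattern.inv (τ : HPattern) : HPattern := ⟨τ.size, τ.two_le, τ.perm⁻¹⟩

/-- `τ` is an involution, that is, it is its own inverse. -/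
def HPattern.IsInvolution (τ : HPattern) : Prop := τ.perm⁻¹ = τ.perm

/-- Location of an occurrence `β` in a permutation: the triple
(first position of `β`, smallest symbol of `β`, length of `β`). -/
abbrev Occ := ℕ × ℕ × ℕ

/-- the position at which the factor starts -/
def Occ.pos (o : Occ) : ℕ := o.1

/-- the smallest symbol of the factor -/
def Occ.val (o : Occ) : ℕ := o.2.1

/-- the length of the factor -/
def Occ.len (o : Occ) : ℕ := o.2.2

/-- `o` locates an occurrence of the pattern `τ` in `π`: the factor `b_0 b_1 … b_{k-1}` of `π`
starting at position `o.pos` satisfies `b_i - τ(i) = c` for all `i`, with `c = o.val`.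
(As `τ` takes the value `0`, the constant `c` is a symbol of `π`, in particular nonnegative,
and it is determined by `o.pos`.) -/
def IsOcc {n : ℕ} (τ : HPattern) (π : Equiv.Perm (Fin n)) (o : Occ) : Prop :=
  o.len = τ.size ∧
    ∀ i : Fin τ.size, ∃ h : o.pos + i < n, (π ⟨o.pos + i, h⟩ : ℕ) = τ.perm i + o.val

/-- `τ ≤ π`: the H-pattern `τ` occurs in `π`. -/
def Occurs {n : ℕ} (τ : HPattern) (π : Equiv.Perm (Fin n)) : Prop := ∃ o, IsOcc τ π o

/-- A set of patterns is simple if none of its elements is an H-pattern of the others. -/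
def IsSimple (T : Set HPattern) : Prop :=
  ∀ τ ∈ T, ∀ σ ∈ T, τ ≠ σ → ¬ Occurs τ σ.perm

/-- A set of patterns is self-inverse if `τ ∈ T` whenever `τ⁻¹ ∈ T`. -/
def IsSelfInverse (T : Set HPattern) : Prop := ∀ τ : HPattern, τ.inv ∈ T → τ ∈ T

/-- `T_I`, the set of involutions in `T`. -/
def involutive (T : Set HPattern) : Set HPattern := {τ | τ ∈ T ∧ τ.IsInvolution}

/-- `T = T_I ⊔ T_L ⊔ T_L⁻¹`, where `T_L⁻¹` consists of the inverses of the elements of `T_L`. -/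
def IsHalf (T TL : Set HPattern) : Prop :=
  TL ∪ HPattern.inv '' TL = T \ involutive T ∧ Disjoint TL (HPattern.inv '' TL)

/-- The finite set of all occurrences in `π` of patterns from `T`. -/
noncomputable def occurrences (T : Set HPattern) {n : ℕ} (π : Equiv.Perm (Fin n)) : Finset Occ :=
  (range n ×ˢ range n ×ˢ range (n + 1)).filter fun o => ∃ τ ∈ T, IsOcc τ π o

/-- The bounds in `occurrences` lose nothing. -/
theorem mem_occurrences {T : Set HPattern} {n : ℕ} {π : Equiv.Perm (Fin n)} {o : Occ} :
    o ∈ occurrences T π ↔ ∃ τ ∈ T, IsOcc τ π o := by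
  unfold occurrences
  rw [mem_filter, and_iff_right_iff_imp]
  rintro ⟨τ, -, hl, h⟩
  have h2 := τ.two_le
  obtain ⟨p, c, k⟩ := o
  simp only [Occ.pos, Occ.val, Occ.len] at *
  obtain ⟨h0, e0⟩ := h ⟨0, by omega⟩
  obtain ⟨h1, -⟩ := h ⟨τ.size - 1, by omega⟩
  have hb := (π ⟨p + 0, h0⟩).isLt
  simp only [mem_product, mem_range] at *
  refine ⟨by omega, by omega, by omega⟩

/-- `M` is a set of `T`-marked occurrences on `π`, i.e. `(π, M)` is a `T`-marked permutation. -/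
def IsMarked (T : Set HPattern) {n : ℕ} (π : Equiv.Perm (Fin n)) (M : Finset Occ) : Prop :=
  M ⊆ occurrences T π

/-- The marked permutation `(π, M)` of length `n` is the concatenation of two nonempty marked
words: `π = αβ` with `|α| = p`, and `M = M₁ ∪ M₂` with all elements of `M₁` contained in `α` and
all elements of `M₂` contained in `β`. -/
def IsConcatenation (n : ℕ) (M : Finset Occ) : Prop :=
  ∃ (p : ℕ) (M₁ M₂ : Finset Occ), 0 < p ∧ p < n ∧ M = M₁ ∪ M₂ ∧
    (∀ o ∈ M₁, o.pos + o.len ≤ p) ∧ (∀ o ∈ M₂, p ≤ o.pos)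

/-- `(π, M)` is a `T`-cluster. -/
def IsCluster (T : Set HPattern) {n : ℕ} (π : Equiv.Perm (Fin n)) (M : Finset Occ) : Prop :=
  2 ≤ n ∧ IsMarked T π M ∧ ¬ IsConcatenation n M

/-- The sibling of an occurrence in an involution `π`: if the occurrence starts at position `j`,
has smallest symbol `c` and length `k`, then its sibling consists of the symbols `j, …, j + k - 1`,
which occupy the positions `c, …, c + k - 1` of `π`. -/
def sibling (o : Occ) : Occ := (o.val, o.pos, o.len)

/-- `(π, M)` is a `T`-marked involution: `π` is an involution, and `M` contains an occurrence
whenever it contains its sibling. -/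
def IsMarkedInvolution (T : Set HPattern) {n : ℕ} (π : Equiv.Perm (Fin n)) (M : Finset Occ) :
    Prop :=
  π⁻¹ = π ∧ IsMarked T π M ∧ ∀ o, sibling o ∈ M → o ∈ M

/-- `(π, M)` is an involutory `T`-cluster: a `T`-cluster that is a `T`-marked involution. -/
def IsInvolutoryCluster (T : Set HPattern) {n : ℕ} (π : Equiv.Perm (Fin n)) (M : Finset Occ) :
    Prop :=
  IsCluster T π M ∧ IsMarkedInvolution T π M

/-- The number of occurrences of `τ` in `π` that belong to `S`. -/
noncomputable def occCount {n : ℕ} (τ : HPattern) (π : Equiv.Perm (Fin n)) (S : Finset Occ) : ℕ :=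
  #{o ∈ S | IsOcc τ π o}

/-- The number of occurrences of `τ` in `π` that belong to `S` and coincide with their sibling. -/
noncomputable def sibCount {n : ℕ} (τ : HPattern) (π : Equiv.Perm (Fin n)) (S : Finset Occ) : ℕ :=
  #{o ∈ S | IsOcc τ π o ∧ sibling o = o}

/-- The number of occurrences of `τ` in `π` that belong to `S` and differ from their sibling. -/
noncomputable def nsibCount {n : ℕ} (τ : HPattern) (π : Equiv.Perm (Fin n)) (S : Finset Occ) : ℕ :=
  #{o ∈ S | IsOcc τ π o ∧ sibling o ≠ o}

/-- The number of fixed points. -/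
noncomputable def fp {n : ℕ} (π : Equiv.Perm (Fin n)) : ℕ := #{i | π i = i}

/-- The number of cycles of length at least two; for an involution, the number of 2-cycles. -/
def cyc {n : ℕ} (π : Equiv.Perm (Fin n)) : ℕ := Multiset.card π.cycleType

/-- The length of an involution is determined by its numbers of fixed points and 2-cycles. -/
theorem fp_add_two_mul_cyc {n : ℕ} (π : Equiv.Perm (Fin n)) (h : π⁻¹ = π) :
    fp π + 2 * cyc π = n := by
  have h2 : π ^ 2 = 1 := by
    rw [pow_two]; nth_rewrite 1 [← h]; simp
  have hc := Equiv.Perm.pow_prime_eq_one_iff.1 h2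
  have hs := π.sum_cycleType
  rw [Multiset.eq_replicate_card.2 hc, Multiset.sum_replicate] at hs
  have hf := Finset.card_filter_add_card_filter_not (s := (univ : Finset (Fin n)))
    (fun i => π i = i)
  have hsup : π.support = univ.filter fun i => ¬ π i = i := by
    ext i; simp
  rw [hsup] at hs
  simp only [fp, cyc, smul_eq_mul, card_univ, Fintype.card_fin] at *
  convert hf using 2
  rw [mul_comm]
  convert hs

section GeneratingFunctions

variable {R : Type*} [CommRing R]

/-- `I(t, y) = ∑ t ^ fp(π) * y ^ cyc(π)`, the sum over all involutions `π` of any length, as a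
formal power series in `t` (index `0`) and `y` (index `1`). The coefficient of `t ^ a * y ^ b` is
the number of involutions with `a` fixed points and `b` 2-cycles; they have length `a + 2 * b`. -/
noncomputable def involutionGF (R : Type*) [CommRing R] : MvPowerSeries (Fin 2) R := fun d =>
  ((#{π : Equiv.Perm (Fin (d 0 + 2 * d 1)) | π⁻¹ = π ∧ fp π = d 0 ∧ cyc π = d 1} : ℕ) : R)

/-- The cluster generating function `C_T(x, a, b, c)`, a formal power series in `x`, with values
`a τ` (`τ ∈ T_I`), `b σ`, `c σ` (`σ ∈ T_L`) in a commutative ring `R` given to the other variables.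
The exponents of `a τ`, `b σ`, `c σ` are the numbers of marked occurrences of `τ`, `σ`, `σ⁻¹`. -/
noncomputable def clusterGF (T TL : Set HPattern) (a b c : HPattern → R) : PowerSeries R :=
  PowerSeries.mk fun n =>
    ∑ π : Equiv.Perm (Fin n), ∑ M ∈ (occurrences T π).powerset with IsCluster T π M,
      (∏ᶠ τ ∈ involutive T, a τ ^ occCount τ π M) *
      (∏ᶠ σ ∈ TL, b σ ^ occCount σ π M) *
      (∏ᶠ σ ∈ TL, c σ ^ occCount σ.inv π M)

/-- The involutory cluster generating function `CI_T(x, t, u, ū, w)`. The exponents of `u τ`, `ū τ`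
and `w σ` are the numbers of marked occurrences of `τ ∈ T_I` coinciding with their sibling, of
`τ ∈ T_I` not coinciding with their sibling, and of `σ ∈ T_L`. -/
noncomputable def involutoryClusterGF (T TL : Set HPattern) (t : R) (u ubar w : HPattern → R) :
    PowerSeries R :=
  PowerSeries.mk fun n =>
    ∑ π : Equiv.Perm (Fin n), ∑ M ∈ (occurrences T π).powerset with IsInvolutoryCluster T π M,
      t ^ fp π *
      (∏ᶠ τ ∈ involutive T, u τ ^ sibCount τ π M) *
      (∏ᶠ τ ∈ involutive T, ubar τ ^ nsibCount τ π M) *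
      (∏ᶠ σ ∈ TL, w σ ^ occCount σ π M)

/-- The generating function `F_T(x, t, u, ū, w)` of all involutions by length, fixed points and
occurrences of the patterns in `T`. -/
noncomputable def patternGF (T TL : Set HPattern) (t : R) (u ubar w : HPattern → R) :
    PowerSeries R :=
  PowerSeries.mk fun n =>
    ∑ π : Equiv.Perm (Fin n) with π⁻¹ = π,
      t ^ fp π *
      (∏ᶠ τ ∈ involutive T, u τ ^ sibCount τ π (occurrences T π)) *
      (∏ᶠ τ ∈ involutive T, ubar τ ^ nsibCount τ π (occurrences T π)) *
      (∏ᶠ σ ∈ TL, w σ ^ occCount σ π (occurrences T π))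

/-- The substitution `f(x) ↦ f(x ^ 2)`. -/
noncomputable def atXSq (f : PowerSeries R) : PowerSeries R :=
  PowerSeries.subst (PowerSeries.X ^ 2 : PowerSeries R) f

/-- The composite `I(A, B)`, for formal power series `A`, `B` in `x` without constant term. -/
noncomputable def involutionGFAt (A B : PowerSeries R) : PowerSeries R :=
  MvPowerSeries.subst (![A, B] : Fin 2 → MvPowerSeries Unit R) (involutionGF R)

/-- The composition in `involutionGFAt` is meaningful if `A` and `B` have no constant term. -/
theorem hasSubst_pair (A B : PowerSeries R) (hA : PowerSeries.constantCoeff A = 0)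
    (hB : PowerSeries.constantCoeff B = 0) :
    MvPowerSeries.HasSubst (![A, B] : Fin 2 → MvPowerSeries Unit R) := by
  apply MvPowerSeries.hasSubst_of_constantCoeff_zero
  intro i
  fin_cases i
  · exact hA
  · exact hB

theorem constantCoeff_involutoryClusterGF (T TL : Set HPattern) (t : R) (u ubar w : HPattern → R) :
    PowerSeries.constantCoeff (involutoryClusterGF T TL t u ubar w) = 0 := by
  rw [← PowerSeries.coeff_zero_eq_constantCoeff_apply, involutoryClusterGF, PowerSeries.coeff_mk]
  refine sum_eq_zero fun π _ => ?_
  rw [filter_false_of_mem, sum_empty]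
  rintro M - ⟨⟨h, -⟩, -⟩
  omega

theorem constantCoeff_clusterGF (T TL : Set HPattern) (a b c : HPattern → R) :
    PowerSeries.constantCoeff (clusterGF T TL a b c) = 0 := by
  rw [← PowerSeries.coeff_zero_eq_constantCoeff_apply, clusterGF, PowerSeries.coeff_mk]
  refine sum_eq_zero fun π _ => ?_
  rw [filter_false_of_mem, sum_empty]
  rintro M - ⟨h, -⟩
  omega

end GeneratingFunctions

end Hertzsprung

/-!
The weight of an involution `π` is expanded over sets `M` of marked occurrences closed under
siblings: the occurrences of patterns from `T` fall into orbits under `sibling`, a fixed occurrence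
of `τ` has the factor `u τ = 1 + (u τ - 1)`, a pair of siblings has the factor
`ubar τ ^ 2 = 1 + s τ ^ 2` or `w σ = 1 + (w σ - 1)`, and expanding the product over the orbits
gives a sum over marked involutions (`prod_eq_sum_closed`, `coeff_patternGF`).

A marked permutation is cut at every gap that no mark crosses. The pieces are single points and
clusters. In a marked involution `(π, M)` the involution `π` maps pieces to pieces: if `x` and
`x + 1` lie in a common piece, some mark contains both, and its sibling, which contains their
images, prevents a cut between these. So `π` permutes the pieces by an involution `ρ`, and the
piece at `ρ i` is the inverse of the piece at `i`. Conversely, such data can be inflated to a marked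
involution, and the pieces are recovered from the cuts. This bijection is given by the lemmas
`MarkedPerm.IsInv.exists_skeleton`, `Skeleton.Valid.exists_inflation`, `IsInflation.eq_left` and
`IsInflation.eq_right`. The weights multiply (`IsInflation.invWeight_eq_prod`): a fixed point of `ρ`
carries a point or an involutory cluster, and a 2-cycle of `ρ` carries an arbitrary point or cluster
together with its inverse. A mark in a moved piece is never its own sibling, so the two pieces of
a 2-cycle contribute `s τ ^ 2 = ubar τ ^ 2 - 1` for each mark of `τ ∈ T_I` in one of them, and
`w σ - 1` for each mark of `σ` or `σ⁻¹` with `σ ∈ T_L`.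

On the other side, the coefficients of the composite are sums over involutions `ρ` of products over
the fixed points and 2-cycles of `ρ` (`coeff_involutionGFAt`), and these products expand into sums
over families of pieces (`coeff_prod_sum`).

To avoid casts between the types `Fin n`, permutations are extended to `ℕ` by the identity, and
sequences of pieces by single points; the cuts then form the range of a strictly increasing
sequence `ℕ → ℕ`, which is determined by this range.
-/

namespace Hertzsprung

/-! ### Marked permutations as words on `ℕ` -/

/-- A permutation of `Fin n` as a function on `ℕ`, extended by the identity. -/
def extend {n : ℕ} (π : Equiv.Perm (Fin n)) (x : ℕ) : ℕ := if h : x < n then π ⟨x, h⟩ else x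

theorem extend_of_lt {n : ℕ} (π : Equiv.Perm (Fin n)) {x : ℕ} (h : x < n) :
    extend π x = π ⟨x, h⟩ := dif_pos h

theorem extend_of_le {n : ℕ} (π : Equiv.Perm (Fin n)) {x : ℕ} (h : n ≤ x) : extend π x = x :=
  dif_neg (by omega)

theorem extend_val {n : ℕ} (π : Equiv.Perm (Fin n)) (i : Fin n) : extend π i = π i :=
  extend_of_lt π i.isLt

theorem extend_lt {n : ℕ} (π : Equiv.Perm (Fin n)) {x : ℕ} (h : x < n) : extend π x < n := by
  rw [extend_of_lt π h]; exact Fin.isLt _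

theorem extend_inv_extend {n : ℕ} (π : Equiv.Perm (Fin n)) (x : ℕ) :
    extend π⁻¹ (extend π x) = x := by
  by_cases h : x < n
  · rw [extend_of_lt π h, extend_val]; simp
  · rw [extend_of_le π (by omega), extend_of_le _ (by omega)]

theorem extend_extend_inv {n : ℕ} (π : Equiv.Perm (Fin n)) (x : ℕ) :
    extend π (extend π⁻¹ x) = x := by
  simpa using extend_inv_extend π⁻¹ x

theorem extend_injective {n : ℕ} (π : Equiv.Perm (Fin n)) : Function.Injective (extend π) :=
  Function.LeftInverse.injective (extend_inv_extend π)

theorem extend_inj {n : ℕ} {π ρ : Equiv.Perm (Fin n)} (h : extend π = extend ρ) : π = ρ := by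
  ext i
  rw [← extend_val, ← extend_val, h]

theorem extend_lt_iff {n : ℕ} (π : Equiv.Perm (Fin n)) {x : ℕ} : extend π x < n ↔ x < n := by
  refine ⟨fun h => ?_, extend_lt π⟩
  by_contra hx
  rw [extend_of_le π (by omega)] at h
  exact hx h

/-- A self-map of `[0, k)` that is injective there comes from a permutation. -/
theorem exists_perm (k : ℕ) (f : ℕ → ℕ) (hf : ∀ x < k, f x < k)
    (hinj : ∀ x < k, ∀ y < k, f x = f y → x = y) :
    ∃ π : Equiv.Perm (Fin k), ∀ x < k, extend π x = f x := by
  let g : Fin k → Fin k := fun i => ⟨f i, hf i i.isLt⟩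
  have hg : Function.Injective g := fun i j h =>
    Fin.ext (hinj i i.isLt j j.isLt (congrArg Fin.val h))
  refine ⟨Equiv.ofBijective g (Finite.injective_iff_bijective.1 hg), fun x hx => ?_⟩
  rw [extend_of_lt _ hx]
  rfl

/-- A marked word: a permutation of `Fin n`, for some `n`, with a set of locations. -/
abbrev MarkedPerm := Σ n : ℕ, Equiv.Perm (Fin n) × Finset Occ

namespace MarkedPerm

/-- the length of the permutation -/
abbrev size (P : MarkedPerm) : ℕ := P.1

/-- the permutation, extended by the identity -/
abbrev fn (P : MarkedPerm) : ℕ → ℕ := extend P.2.1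

/-- the set of marked locations -/
abbrev marks (P : MarkedPerm) : Finset Occ := P.2.2

theorem fn_lt (P : MarkedPerm) {x : ℕ} (h : x < P.size) : P.fn x < P.size := extend_lt _ h

theorem fn_of_le (P : MarkedPerm) {x : ℕ} (h : P.size ≤ x) : P.fn x = x := extend_of_le _ h

theorem ext' {P Q : MarkedPerm} (h1 : P.size = Q.size) (h2 : P.fn = Q.fn)
    (h3 : P.marks = Q.marks) : P = Q := by
  obtain ⟨n, π, M⟩ := P
  obtain ⟨m, ρ, N⟩ := Q
  obtain rfl : n = m := h1
  obtain rfl : π = ρ := extend_inj h2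
  obtain rfl : M = N := h3
  rfl

end MarkedPerm

theorem sibling_sibling (o : Occ) : sibling (sibling o) = o := rfl

theorem sibling_injective : Function.Injective sibling :=
  Function.LeftInverse.injective sibling_sibling

theorem sibling_eq_self {o : Occ} : sibling o = o ↔ o.pos = o.val := by
  obtain ⟨p, v, l⟩ := o
  simp only [sibling, Occ.pos, Occ.val, Occ.len, Prod.mk.injEq, and_true]
  omega

theorem mem_image_sibling {o : Occ} {M : Finset Occ} :
    o ∈ M.image sibling ↔ sibling o ∈ M := by
  rw [mem_image]
  refine ⟨?_, fun h => ⟨_, h, sibling_sibling o⟩⟩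
  rintro ⟨a, ha, rfl⟩
  rwa [sibling_sibling]

/-- `IsOcc` for a permutation of `[0, n)` given as a function on `ℕ`. -/
def IsOccFn (τ : HPattern) (f : ℕ → ℕ) (n : ℕ) (o : Occ) : Prop :=
  o.len = τ.size ∧ o.pos + o.len ≤ n ∧ ∀ i : Fin τ.size, f (o.pos + i) = τ.perm i + o.val

theorem isOcc_iff {n : ℕ} {τ : HPattern} {π : Equiv.Perm (Fin n)} {o : Occ} :
    IsOcc τ π o ↔ IsOccFn τ (extend π) n o := by
  have h2 := τ.two_le
  constructor
  · rintro ⟨h, h'⟩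
    obtain ⟨h1, -⟩ := h' ⟨τ.size - 1, by omega⟩
    refine ⟨h, ?_, fun i => ?_⟩
    · simp only at h1
      omega
    · obtain ⟨hi, e⟩ := h' i
      rw [extend_of_lt _ hi, e]
  · rintro ⟨h, h1, h'⟩
    refine ⟨h, fun i => ?_⟩
    have hi : o.pos + i < n := by have := i.isLt; omega
    exact ⟨hi, by rw [← h' i, extend_of_lt _ hi]⟩

namespace IsOccFn

variable {τ : HPattern} {f : ℕ → ℕ} {n : ℕ} {o : Occ}

theorem two_le (h : IsOccFn τ f n o) : 2 ≤ o.len := h.1 ▸ τ.two_le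

theorem mapsTo (h : IsOccFn τ f n o) {x : ℕ} (h1 : o.pos ≤ x) (h2 : x < o.pos + o.len) :
    o.val ≤ f x ∧ f x < o.val + o.len := by
  obtain ⟨hl, -, hf⟩ := h
  have := hf ⟨x - o.pos, by omega⟩
  simp only [Nat.add_sub_cancel' h1] at this
  have hlt := (τ.perm ⟨x - o.pos, by omega⟩).isLt
  omega

/-- A location determines the pattern. -/
theorem unique (h : IsOccFn τ f n o) {σ : HPattern} {m : ℕ} (h' : IsOccFn σ f m o) : τ = σ := by
  obtain ⟨k, hk, p⟩ := τ
  obtain ⟨l, hl, q⟩ := σ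
  have e : k = l := h.1.symm.trans h'.1
  subst e
  have : p = q := by
    ext i
    have h1 := h.2.2 i
    have h2 := h'.2.2 i
    simp only at h1 h2
    omega
  rw [this]

end IsOccFn

theorem HPattern.inv_inv (τ : HPattern) : τ.inv.inv = τ := rfl

theorem HPattern.isInvolution_iff {τ : HPattern} : τ.IsInvolution ↔ τ.inv = τ := by
  obtain ⟨k, h, p⟩ := τ
  simp [HPattern.IsInvolution, HPattern.inv]

/-- The sibling of an occurrence of `τ` is an occurrence of `τ⁻¹` in the inverse permutation. -/
theorem IsOccFn.sibling {τ : HPattern} {n : ℕ} {π : Equiv.Perm (Fin n)} {o : Occ}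
    (h : IsOccFn τ (extend π) n o) : IsOccFn τ.inv (extend π⁻¹) n (sibling o) := by
  have hi : ∀ i : Fin τ.size, extend π⁻¹ (o.val + i) = τ.perm⁻¹ i + o.pos := by
    intro i
    have := h.2.2 (τ.perm⁻¹ i)
    rw [Equiv.Perm.coe_inv, Equiv.apply_symm_apply] at this
    rw [add_comm o.val, ← this, extend_inv_extend, add_comm]
    rfl
  refine ⟨h.1, ?_, hi⟩
  have h2 := τ.two_le
  have hlast := hi ⟨τ.size - 1, by omega⟩
  simp only at hlast
  have hlt : extend π⁻¹ (o.val + (τ.size - 1)) < n := by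
    have := (τ.perm⁻¹ ⟨τ.size - 1, by omega⟩).isLt
    have h21 := h.2.1
    have h1 := h.1
    omega
  rw [extend_lt_iff] at hlt
  have h1 := h.1
  simp only [Hertzsprung.sibling, Occ.pos, Occ.val, Occ.len] at *
  omega

namespace MarkedPerm

/-- The inverse of a marked permutation, with the siblings of the marks. -/
def inv (P : MarkedPerm) : MarkedPerm := ⟨P.1, P.2.1⁻¹, P.2.2.image sibling⟩

theorem inv_inv (P : MarkedPerm) : P.inv.inv = P := by
  obtain ⟨n, π, M⟩ := P
  simp only [inv, image_image]
  congr
  exact image_id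

theorem inv_size (P : MarkedPerm) : P.inv.size = P.size := rfl

theorem fn_inv_fn (P : MarkedPerm) (x : ℕ) : P.inv.fn (P.fn x) = x := extend_inv_extend _ _

theorem mem_marks_inv {P : MarkedPerm} {o : Occ} : o ∈ P.inv.marks ↔ sibling o ∈ P.marks :=
  mem_image_sibling

theorem inv_eq_iff {P Q : MarkedPerm} (h1 : Q.size = P.size) (h2 : ∀ x, Q.fn (P.fn x) = x)
    (h3 : ∀ o, o ∈ Q.marks ↔ sibling o ∈ P.marks) : Q = P.inv := by
  refine ext' h1 ?_ ?_
  · funext x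
    rw [← extend_extend_inv P.2.1 x]
    exact (h2 _).trans (P.fn_inv_fn _).symm
  · ext o
    rw [h3, mem_marks_inv]

/-- All marks are occurrences of patterns from `T`. -/
def Marked (T : Set HPattern) (P : MarkedPerm) : Prop :=
  ∀ o ∈ P.marks, ∃ τ ∈ T, IsOccFn τ P.fn P.size o

theorem marked_iff {T : Set HPattern} {P : MarkedPerm} :
    P.Marked T ↔ IsMarked T P.2.1 P.2.2 := by
  simp only [Marked, IsMarked, subset_iff, mem_occurrences, isOcc_iff]

theorem Marked.inv {T : Set HPattern} (hT : IsSelfInverse T) {P : MarkedPerm} (h : P.Marked T) :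
    P.inv.Marked T := by
  intro o ho
  obtain ⟨τ, hτ, ho⟩ := h _ (mem_marks_inv.1 ho)
  exact ⟨τ.inv, hT _ (by rwa [τ.inv_inv]), ho.sibling⟩

/-- No mark extends to both sides of the gap before position `p`. -/
def Cut (P : MarkedPerm) (p : ℕ) : Prop := ∀ o ∈ P.marks, p ≤ o.pos ∨ o.pos + o.len ≤ p

theorem isConcatenation_iff {P : MarkedPerm} :
    IsConcatenation P.1 P.2.2 ↔ ∃ p, 0 < p ∧ p < P.size ∧ P.Cut p := by
  constructor
  · rintro ⟨p, M₁, M₂, h0, hn, e, h1, h2⟩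
    refine ⟨p, h0, hn, fun o ho => ?_⟩
    rw [marks, e, mem_union] at ho
    exact ho.elim (fun h => .inr (h1 o h)) fun h => .inl (h2 o h)
  · rintro ⟨p, h0, hn, h⟩
    refine ⟨p, P.2.2.filter fun o => o.pos + o.len ≤ p, P.2.2.filter fun o => p ≤ o.pos, h0, hn,
      ?_, by simp, by simp⟩
    ext o
    simp only [mem_union, mem_filter]
    have := h o
    tauto

/-- A nonempty marked permutation that is not a concatenation: a single unmarked point or a
`T`-cluster. -/
structure Indecomposable (T : Set HPattern) (P : MarkedPerm) : Prop where
  pos : 0 < P.size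
  marked : P.Marked T
  not_cut : ∀ p, 0 < p → p < P.size → ¬ P.Cut p

theorem indecomposable_iff_isCluster {T : Set HPattern} {P : MarkedPerm} (h : 2 ≤ P.size) :
    P.Indecomposable T ↔ IsCluster T P.2.1 P.2.2 := by
  rw [IsCluster, ← marked_iff, isConcatenation_iff]
  push Not
  exact ⟨fun ⟨_, h2, h3⟩ => ⟨h, h2, h3⟩, fun ⟨_, h2, h3⟩ => ⟨by omega, h2, h3⟩⟩

theorem indecomposable_iff_of_size_eq_one {T : Set HPattern} {P : MarkedPerm} (h : P.size = 1) :
    P.Indecomposable T ↔ P.marks = ∅ := by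
  constructor
  · rintro ⟨-, h2, -⟩
    refine eq_empty_of_forall_notMem fun o ho => ?_
    obtain ⟨τ, -, hτ⟩ := h2 o ho
    have := hτ.two_le
    have := hτ.2.1
    omega
  · intro h'
    refine ⟨by omega, fun o ho => ?_, fun p h0 h1 => by omega⟩
    rw [h'] at ho
    exact absurd ho (notMem_empty o)

/-- A property of positions that is constant on each mark is constant on an indecomposable
marked permutation. -/
theorem Indecomposable.connected {T : Set HPattern} {P : MarkedPerm} (h : P.Indecomposable T)
    (c : ℕ → Prop) (hc : ∀ o ∈ P.marks, ∀ x y, o.pos ≤ x → x < o.pos + o.len → o.pos ≤ y →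
      y < o.pos + o.len → (c x ↔ c y)) {x : ℕ} (hx : x < P.size) : c x ↔ c 0 := by
  induction x with
  | zero => rfl
  | succ x ih =>
    rw [← ih (by omega)]
    have := h.not_cut (x + 1) (by omega) hx
    unfold Cut at this
    push Not at this
    obtain ⟨o, ho, h1, h2⟩ := this
    exact hc o ho _ _ (by omega) (by omega) (by omega) (by omega)

theorem Indecomposable.inv {T : Set HPattern} (hT : IsSelfInverse T) {P : MarkedPerm}
    (h : P.Indecomposable T) : P.inv.Indecomposable T := by
  refine ⟨h.pos, h.marked.inv hT, fun p h0 hp hcut => ?_⟩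
  rw [inv_size] at hp
  -- a cut of the inverse is a value `p` such that no mark has values on both sides of it
  have key : ∀ x < P.size, (P.fn x < p ↔ P.fn 0 < p) := fun x hx => by
    refine h.connected (fun x => P.fn x < p) (fun o ho x y hx1 hx2 hy1 hy2 => ?_) hx
    obtain ⟨τ, -, hτ⟩ := h.marked o ho
    have h1 := hτ.mapsTo hx1 hx2
    have h2 := hτ.mapsTo hy1 hy2
    have h3 : p ≤ o.val ∨ o.val + o.len ≤ p := hcut (sibling o) (mem_marks_inv.2 ho)
    omega
  have hsurj : ∀ y < P.size, ∃ x < P.size, P.fn x = y := fun y hy =>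
    ⟨extend P.2.1⁻¹ y, extend_lt _ hy, extend_extend_inv _ _⟩
  obtain ⟨x, hx, ex⟩ := hsurj 0 h.pos
  obtain ⟨y, hy, ey⟩ := hsurj p hp
  have h1 := key x hx
  have h2 := key y hy
  omega

end MarkedPerm

/-! ### Division of `ℕ` into consecutive intervals -/

theorem exists_between {s : ℕ → ℕ} (h0 : s 0 = 0) (hs : StrictMono s) (x : ℕ) :
    ∃ i, s i ≤ x ∧ x < s (i + 1) := by
  induction x with
  | zero => exact ⟨0, by omega, by have := hs (show 0 < 0 + 1 by omega); omega⟩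
  | succ x ih =>
    obtain ⟨i, h1, h2⟩ := ih
    by_cases h : x + 1 < s (i + 1)
    · exact ⟨i, by omega, h⟩
    · exact ⟨i + 1, by omega, by have := hs (show i + 1 < i + 1 + 1 by omega); omega⟩

theorem between_unique {s : ℕ → ℕ} (hs : StrictMono s) {x i j : ℕ} (h1 : s i ≤ x)
    (h2 : x < s (i + 1)) (h3 : s j ≤ x) (h4 : x < s (j + 1)) : i = j := by
  have h5 := hs.lt_iff_lt.1 (lt_of_le_of_lt h1 h4)
  have h6 := hs.lt_iff_lt.1 (lt_of_le_of_lt h3 h2)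
  omega

/-! ### Inflations -/

/-- The marked permutation consisting of one unmarked point. -/
def point : MarkedPerm := ⟨1, 1, ∅⟩

theorem point_indecomposable (T : Set HPattern) : point.Indecomposable T :=
  (MarkedPerm.indecomposable_iff_of_size_eq_one rfl).2 rfl

theorem point_inv : point.inv = point := by
  simp only [point, MarkedPerm.inv, image_empty]
  rfl

/-- Move a location by `a` positions and `c` symbols. -/
def shift (a c : ℕ) (o : Occ) : Occ := (o.pos + a, o.val + c, o.len)

theorem shift_injective (a c : ℕ) : Function.Injective (shift a c) := by
  rintro ⟨p, v, l⟩ ⟨p', v', l'⟩ h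
  simp only [shift, Occ.pos, Occ.val, Occ.len, Prod.mk.injEq] at h ⊢
  omega

/-- Data for an inflation: a permutation of `m` blocks and a marked permutation for each block. -/
abbrev Skeleton := Σ m : ℕ, Equiv.Perm (Fin m) × (Fin m → MarkedPerm)

namespace Skeleton

/-- the permutation of the blocks, extended by the identity -/
abbrev perm (q : Skeleton) : ℕ → ℕ := extend q.2.1

/-- the sequence of blocks, extended by single points -/
def block (q : Skeleton) (i : ℕ) : MarkedPerm := if h : i < q.1 then q.2.2 ⟨i, h⟩ else point

/-- the position at which a block starts -/
def start (q : Skeleton) (i : ℕ) : ℕ := ∑ j ∈ range i, (q.block j).size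

theorem block_of_lt (q : Skeleton) {i : ℕ} (h : i < q.1) : q.block i = q.2.2 ⟨i, h⟩ := dif_pos h

theorem block_of_le (q : Skeleton) {i : ℕ} (h : q.1 ≤ i) : q.block i = point :=
  dif_neg (by omega)

theorem block_val (q : Skeleton) (i : Fin q.1) : q.block i = q.2.2 i := q.block_of_lt i.isLt

theorem start_zero (q : Skeleton) : q.start 0 = 0 := rfl

theorem start_succ (q : Skeleton) (i : ℕ) : q.start (i + 1) = q.start i + (q.block i).size :=
  sum_range_succ _ _

theorem ext' {q r : Skeleton} (h1 : q.1 = r.1) (h2 : q.perm = r.perm)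
    (h3 : ∀ i, q.block i = r.block i) : q = r := by
  obtain ⟨m, ρ, b⟩ := q
  obtain ⟨m', ρ', b'⟩ := r
  obtain rfl : m = m' := h1
  obtain rfl : ρ = ρ' := extend_inj h2
  obtain rfl : b = b' := by
    funext i
    have := h3 i
    rwa [block_val, block_val] at this
  rfl

/-- The permutation of the blocks is an involution, and it exchanges inverse blocks. -/
structure Valid (T : Set HPattern) (q : Skeleton) : Prop where
  inv_perm : q.2.1⁻¹ = q.2.1
  indecomposable : ∀ i, (q.2.2 i).Indecomposable T
  inv_block : ∀ i, q.2.2 (q.2.1 i) = (q.2.2 i).inv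

section Valid

variable {T : Set HPattern} {q : Skeleton}

theorem Valid.block_indecomposable (h : q.Valid T) (i : ℕ) : (q.block i).Indecomposable T := by
  by_cases hi : i < q.1
  · rw [q.block_of_lt hi]; exact h.indecomposable _
  · rw [q.block_of_le (by omega)]; exact point_indecomposable T

theorem Valid.perm_perm (h : q.Valid T) (i : ℕ) : q.perm (q.perm i) = i := by
  have := extend_inv_extend q.2.1 i
  rwa [h.inv_perm] at this

theorem Valid.block_perm (h : q.Valid T) (i : ℕ) : q.block (q.perm i) = (q.block i).inv := by
  by_cases hi : i < q.1
  · rw [perm, extend_of_lt _ hi, q.block_val, h.inv_block, q.block_of_lt hi]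
  · rw [perm, extend_of_le _ (by omega), q.block_of_le (by omega), point_inv]

theorem Valid.size_perm (h : q.Valid T) (i : ℕ) :
    (q.block (q.perm i)).size = (q.block i).size := by
  rw [h.block_perm]; rfl

theorem Valid.strictMono (h : q.Valid T) : StrictMono q.start :=
  strictMono_nat_of_lt_succ fun i => by
    have := (h.block_indecomposable i).pos
    rw [start_succ]; omega

theorem Valid.exists_eq (h : q.Valid T) (x : ℕ) :
    ∃ i y, y < (q.block i).size ∧ x = q.start i + y := by
  obtain ⟨i, h1, h2⟩ := exists_between q.start_zero h.strictMono x
  rw [start_succ] at h2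
  exact ⟨i, x - q.start i, by omega, by omega⟩

theorem Valid.eq_of_eq (h : q.Valid T) {i j x y : ℕ} (hx : x < (q.block i).size)
    (hy : y < (q.block j).size) (e : q.start i + x = q.start j + y) : i = j ∧ x = y := by
  obtain rfl : i = j := between_unique h.strictMono (x := q.start i + x) (by omega)
    (by rw [start_succ]; omega) (by omega) (by rw [start_succ]; omega)
  exact ⟨rfl, by omega⟩

end Valid

end Skeleton

/-- `P` is obtained from the permutation of blocks given by `q` by replacing each block by
the marked permutation of `q`. The symbols of block `i` start at the position of block `q.perm i`,
which is right as `q.perm` is supposed to be an involution exchanging blocks of the same size. -/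
structure IsInflation (q : Skeleton) (P : MarkedPerm) : Prop where
  size : q.start q.1 = P.size
  fn : ∀ i x, x < (q.block i).size → P.fn (q.start i + x) = q.start (q.perm i) + (q.block i).fn x
  marks : ∀ o, o ∈ P.marks ↔
    ∃ i, ∃ o' ∈ (q.block i).marks, o = shift (q.start i) (q.start (q.perm i)) o'

/-- `P` is a `T`-marked involution. -/
structure MarkedPerm.IsInv (T : Set HPattern) (P : MarkedPerm) : Prop where
  inv : P.inv = P
  marked : P.Marked T

namespace IsInflation

variable {T : Set HPattern} {q r : Skeleton} {P Q : MarkedPerm}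

/-- The inflation is determined by its data. -/
theorem eq_right (hq : q.Valid T) (h : IsInflation q P) (h' : IsInflation q Q) : P = Q := by
  refine MarkedPerm.ext' (h.size.symm.trans h'.size) ?_ ?_
  · funext x
    obtain ⟨i, y, hy, rfl⟩ := hq.exists_eq x
    rw [h.fn i y hy, h'.fn i y hy]
  · ext o
    rw [h.marks, h'.marks]

theorem pos_lt {P : MarkedPerm} (h : P.Marked T) {o : Occ} (ho : o ∈ P.marks) :
    o.pos < P.size ∧ o.pos + o.len ≤ P.size ∧ 2 ≤ o.len := by
  obtain ⟨τ, -, hτ⟩ := h o ho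
  have := hτ.two_le
  have := hτ.2.1
  omega

/-- The cuts of an inflation are the starts of its blocks, as the blocks are indecomposable. -/
theorem cut_iff (hq : q.Valid T) (h : IsInflation q P) {p : ℕ} :
    P.Cut p ↔ p ∈ Set.range q.start := by
  constructor
  · intro hp
    obtain ⟨i, y, hy, rfl⟩ := hq.exists_eq p
    rcases Nat.eq_zero_or_pos y with rfl | h0
    · exact ⟨i, rfl⟩
    · exfalso
      refine (hq.block_indecomposable i).not_cut y h0 hy fun o ho => ?_
      have := hp _ ((h.marks _).2 ⟨i, o, ho, rfl⟩)
      simp only [shift, Occ.pos, Occ.val, Occ.len] at this ⊢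
      omega
  · rintro ⟨j, rfl⟩ o ho
    obtain ⟨i, o', ho', rfl⟩ := (h.marks o).1 ho
    have := pos_lt (hq.block_indecomposable i).marked ho'
    have h1 := q.start_succ i
    have h2 : j ≤ i ∨ i + 1 ≤ j := by omega
    rw [← hq.strictMono.le_iff_le, ← hq.strictMono.le_iff_le (a := i + 1)] at h2
    simp only [shift, Occ.pos, Occ.val, Occ.len] at this ⊢
    omega

/-- The condition on `o.pos` excludes the marks of later blocks. -/
theorem mem_block_marks (hq : q.Valid T) (h : IsInflation q P) {i : ℕ} {o : Occ} :
    o ∈ (q.block i).marks ↔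
      o.pos < (q.block i).size ∧ shift (q.start i) (q.start (q.perm i)) o ∈ P.marks := by
  constructor
  · exact fun ho => ⟨(pos_lt (hq.block_indecomposable i).marked ho).1, (h.marks _).2 ⟨i, o, ho, rfl⟩⟩
  · rintro ⟨h1, h2⟩
    obtain ⟨j, o', ho', e⟩ := (h.marks _).1 h2
    have h3 := pos_lt (hq.block_indecomposable j).marked ho'
    have e' : o.pos + q.start i = o'.pos + q.start j := congrArg Prod.fst e
    obtain ⟨rfl, -⟩ := hq.eq_of_eq h1 h3.1 (by omega)
    rwa [shift_injective _ _ e]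

/-- The inflation data are recovered from the marked permutation. -/
theorem eq_left (hq : q.Valid T) (hr : r.Valid T) (h : IsInflation q P) (h' : IsInflation r P) :
    q = r := by
  have hs : q.start = r.start := by
    rw [← StrictMono.range_inj hq.strictMono hr.strictMono]
    ext p
    rw [← h.cut_iff hq, h'.cut_iff hr]
  have hk : ∀ i, (q.block i).size = (r.block i).size := fun i => by
    have h1 := q.start_succ i
    have h2 := r.start_succ i
    rw [hs] at h1
    omega
  have hfn : ∀ i, ∀ x < (q.block i).size, q.perm i = r.perm i ∧
      (q.block i).fn x = (r.block i).fn x := by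
    intro i x hx
    have h1 := h.fn i x hx
    have h2 := h'.fn i x (hx.trans_eq (hk i))
    rw [← hs, h1] at h2
    refine hq.eq_of_eq ?_ ?_ h2
    · rw [hq.size_perm]; exact extend_lt _ hx
    · rw [hk, hr.size_perm]; exact extend_lt _ (hx.trans_eq (hk i))
  have hperm : ∀ i, q.perm i = r.perm i := fun i =>
    (hfn i 0 (hq.block_indecomposable i).pos).1
  refine Skeleton.ext' ?_ (funext hperm) fun i => ?_
  · apply hq.strictMono.injective
    rw [h.size, hs, h'.size]
  · refine MarkedPerm.ext' (hk i) ?_ ?_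
    · funext x
      by_cases hx : x < (q.block i).size
      · exact (hfn i x hx).2
      · rw [MarkedPerm.fn_of_le _ (by omega), MarkedPerm.fn_of_le _ (by have := hk i; omega)]
    · ext o
      rw [h.mem_block_marks hq, h'.mem_block_marks hr, hk, hs, hperm]

end IsInflation

/-- Valid data have an inflation, which is a marked involution. -/
theorem Skeleton.Valid.exists_inflation {T : Set HPattern} {q : Skeleton} (hq : q.Valid T) :
    ∃ P : MarkedPerm, P.IsInv T ∧ IsInflation q P := by
  choose idx off hoff hx using hq.exists_eq
  have hidx : ∀ i y, y < (q.block i).size → idx (q.start i + y) = i ∧ off (q.start i + y) = y := by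
    intro i y hy
    obtain ⟨h1, h2⟩ := hq.eq_of_eq hy (hoff (q.start i + y)) (hx _)
    exact ⟨h1.symm, h2.symm⟩
  let f : ℕ → ℕ := fun x => q.start (q.perm (idx x)) + (q.block (idx x)).fn (off x)
  have hf : ∀ i y, y < (q.block i).size →
      f (q.start i + y) = q.start (q.perm i) + (q.block i).fn y := by
    intro i y hy
    simp only [f, (hidx i y hy).1, (hidx i y hy).2]
  have hff : ∀ x, f (f x) = x := by
    intro x
    obtain ⟨i, y, hy, rfl⟩ := hq.exists_eq x
    rw [hf i y hy, hf _ _ (by rw [hq.size_perm]; exact extend_lt _ hy), hq.perm_perm,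
      hq.block_perm, MarkedPerm.fn_inv_fn]
  have hlt : ∀ x < q.start q.1, f x < q.start q.1 := by
    intro x hx
    obtain ⟨i, y, hy, rfl⟩ := hq.exists_eq x
    have hi : i < q.1 := by
      rw [← hq.strictMono.lt_iff_lt]; omega
    have h1 : q.perm i + 1 ≤ q.1 := extend_lt _ hi
    have h2 := hq.strictMono.monotone h1
    have h3 := q.start_succ (q.perm i)
    have h4 : (q.block i).fn y < (q.block i).size := extend_lt _ hy
    rw [hq.size_perm] at h3
    rw [hf i y hy]
    omega
  obtain ⟨π, hπ⟩ := exists_perm (q.start q.1) f hlt fun x _ y _ h => by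
    rw [← hff x, h, hff]
  have hge : ∀ x, q.start q.1 ≤ x → f x = x := by
    intro x hx
    obtain ⟨i, y, hy, rfl⟩ := hq.exists_eq x
    have hi : q.1 ≤ i := by
      by_contra! h
      have h1 := hq.strictMono.monotone (show i + 1 ≤ q.1 from h)
      rw [q.start_succ] at h1
      omega
    rw [hf i y hy, Skeleton.perm, extend_of_le _ hi, q.block_of_le hi]
    rw [q.block_of_le hi] at hy
    have hy : y < 1 := hy
    obtain rfl : y = 0 := by omega
    rfl
  have hπf : extend π = f := by
    funext x
    by_cases hx : x < q.start q.1
    · exact hπ x hx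
    · rw [hge x (by omega), extend_of_le _ (by omega)]
  let M : Finset Occ := (range q.1).biUnion fun i =>
    (q.block i).marks.image (shift (q.start i) (q.start (q.perm i)))
  have hM : ∀ o, o ∈ M ↔
      ∃ i, ∃ o' ∈ (q.block i).marks, o = shift (q.start i) (q.start (q.perm i)) o' := by
    intro o
    simp only [M, mem_biUnion, mem_range, mem_image]
    constructor
    · rintro ⟨i, -, o', ho', rfl⟩
      exact ⟨i, o', ho', rfl⟩
    · rintro ⟨i, o', ho', rfl⟩
      refine ⟨i, ?_, o', ho', rfl⟩
      by_contra hi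
      rw [q.block_of_le (by omega)] at ho'
      exact notMem_empty _ ho'
  let P : MarkedPerm := ⟨q.start q.1, π, M⟩
  refine ⟨P, ⟨?_, ?_⟩, ⟨rfl, fun i x hx => ?_, hM⟩⟩
  · refine (MarkedPerm.inv_eq_iff rfl (fun x => ?_) fun o => ?_).symm
    · change extend π (extend π x) = x
      rw [hπf, hff]
    · have hsib : ∀ o, o ∈ M → sibling o ∈ M := by
        intro o
        rw [hM, hM]
        rintro ⟨i, o', ho', rfl⟩
        refine ⟨q.perm i, sibling o', ?_, ?_⟩
        · rw [hq.block_perm, MarkedPerm.mem_marks_inv]; exact ho'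
        · rw [hq.perm_perm]; rfl
      exact ⟨hsib o, hsib (sibling o)⟩
  · intro o ho
    obtain ⟨i, o', ho', rfl⟩ := (hM o).1 ho
    obtain ⟨τ, hτ, h1, h2, h3⟩ := (hq.block_indecomposable i).marked o' ho'
    have hi : i < q.1 := by
      by_contra hi
      rw [q.block_of_le (by omega)] at ho'
      exact notMem_empty _ ho'
    have h4 := hq.strictMono.monotone (show i + 1 ≤ q.1 from hi)
    rw [q.start_succ] at h4
    refine ⟨τ, hτ, h1, ?_, fun j => ?_⟩
    · change o'.pos + q.start i + o'.len ≤ q.start q.1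
      omega
    · change extend π (o'.pos + q.start i + j) = τ.perm j + (o'.val + q.start (q.perm i))
      have h5 := hf i (o'.pos + j) (by have := j.isLt; omega)
      rw [h3 j] at h5
      rw [hπf, show o'.pos + q.start i + j = q.start i + (o'.pos + j) by omega, h5]
      omega
  · change extend π _ = _
    rw [hπf, hf i x hx]

/-! ### Decomposition of a marked involution into blocks -/

namespace MarkedPerm

variable {T : Set HPattern} {P : MarkedPerm}

theorem IsInv.fn_fn (h : P.IsInv T) (x : ℕ) : P.fn (P.fn x) = x := by
  have := P.fn_inv_fn x
  rwa [h.inv] at this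

theorem IsInv.sibling_mem (h : P.IsInv T) {o : Occ} (ho : o ∈ P.marks) : sibling o ∈ P.marks := by
  rw [← mem_marks_inv, h.inv]
  exact ho

theorem Marked.cut_of_le (h : P.Marked T) {p : ℕ} (hp : P.size ≤ p) : P.Cut p := fun o ho => by
  obtain ⟨τ, -, hτ⟩ := h o ho
  have := hτ.2.1
  omega

/-- The cuts of a marked permutation are the values of a strictly increasing sequence. -/
theorem Marked.exists_starts (h : P.Marked T) : ∃ s : ℕ → ℕ, s 0 = 0 ∧ StrictMono s ∧
    ∀ p, P.Cut p ↔ p ∈ Set.range s := by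
  have hinf : (Set.ofPred P.Cut).Infinite := by
    refine Set.infinite_of_not_bddAbove fun ⟨b, hb⟩ => ?_
    have := hb (h.cut_of_le (show P.size ≤ P.size + b + 1 by omega))
    omega
  refine ⟨Nat.nth P.Cut, Nat.nth_zero_of_zero fun o _ => .inl (Nat.zero_le _),
    Nat.nth_strictMono hinf, fun p => ?_⟩
  rw [Nat.range_nth_of_infinite hinf]
  rfl

/-- Positions in a common block are mapped to positions in a common block: for each gap that is not
a cut, there is a mark across it, and the sibling of this mark prevents a cut between the images. -/
theorem IsInv.block_image (h : P.IsInv T) {s : ℕ → ℕ} (hs : ∀ p, P.Cut p ↔ p ∈ Set.range s)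
    (hmono : StrictMono s) {i j y : ℕ} (h1 : s j ≤ P.fn (s i)) (h2 : P.fn (s i) < s (j + 1))
    (hy : s i + y < s (i + 1)) : s j ≤ P.fn (s i + y) ∧ P.fn (s i + y) < s (j + 1) := by
  induction y with
  | zero => exact ⟨h1, h2⟩
  | succ y ih =>
    have ih := ih (by omega)
    have hcut : ¬ P.Cut (s i + (y + 1)) := by
      rw [hs]
      rintro ⟨l, hl⟩
      have h3 : i < l := hmono.lt_iff_lt.1 (by omega)
      have h4 : l < i + 1 := hmono.lt_iff_lt.1 (by omega)
      omega
    unfold Cut at hcut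
    push Not at hcut
    obtain ⟨o, ho, h3, h4⟩ := hcut
    obtain ⟨τ, -, hτ⟩ := h.marked o ho
    have h5 := hτ.mapsTo (x := s i + y) (by omega) (by omega)
    have h6 := hτ.mapsTo (x := s i + (y + 1)) (by omega) (by omega)
    have h7 : s j ≤ o.val ∨ o.val + o.len ≤ s j :=
      (hs (s j)).2 ⟨j, rfl⟩ _ (h.sibling_mem ho)
    have h8 : s (j + 1) ≤ o.val ∨ o.val + o.len ≤ s (j + 1) :=
      (hs (s (j + 1))).2 ⟨j + 1, rfl⟩ _ (h.sibling_mem ho)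
    omega

/-- The permutation of the blocks of a marked involution. -/
theorem IsInv.exists_block_perm (h : P.IsInv T) {s : ℕ → ℕ} (h0 : s 0 = 0) (hmono : StrictMono s)
    (hs : ∀ p, P.Cut p ↔ p ∈ Set.range s) : ∃ r : ℕ → ℕ, (∀ i, r (r i) = i) ∧
      (∀ i, s (r i + 1) - s (r i) = s (i + 1) - s i) ∧
      ∀ i y, s i + y < s (i + 1) → s (r i) ≤ P.fn (s i + y) ∧ P.fn (s i + y) < s (r i + 1) := by
  choose r hr1 hr2 using fun i => exists_between h0 hmono (P.fn (s i))
  have himg : ∀ i y, s i + y < s (i + 1) →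
      s (r i) ≤ P.fn (s i + y) ∧ P.fn (s i + y) < s (r i + 1) :=
    fun i y hy => h.block_image hs hmono (hr1 i) (hr2 i) hy
  have hinv : ∀ i, r (r i) = i := by
    intro i
    have h1 := himg (r i) (P.fn (s i) - s (r i)) (by have := hr1 i; have := hr2 i; omega)
    rw [Nat.add_sub_cancel' (hr1 i), h.fn_fn] at h1
    exact between_unique hmono h1.1 h1.2 le_rfl (hmono (Nat.lt_succ_self i))
  -- injectivity bounds the length of each block by that of its image; apply this twice
  have hle : ∀ i, s (i + 1) - s i ≤ s (r i + 1) - s (r i) := by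
    intro i
    have : #((Ico (s i) (s (i + 1))).image P.fn) ≤ #(Ico (s (r i)) (s (r i + 1))) := by
      refine card_le_card fun z hz => ?_
      obtain ⟨x, hx, rfl⟩ := mem_image.1 hz
      rw [mem_Ico] at hx
      have := himg i (x - s i) (by omega)
      rw [Nat.add_sub_cancel' hx.1] at this
      exact mem_Ico.2 this
    rwa [card_image_of_injective _ (extend_injective _), Nat.card_Ico, Nat.card_Ico] at this
  refine ⟨r, hinv, fun i => le_antisymm ?_ (hle i), himg⟩
  have := hle (r i)
  rwa [hinv] at this

/-- A restriction of a marked permutation to an interval of positions mapped to an interval. -/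
theorem exists_restriction (f : ℕ → ℕ) (hf : Function.Injective f) (M : Finset Occ) {a c k : ℕ}
    (h : ∀ x < k, c ≤ f (a + x) ∧ f (a + x) < c + k) : ∃ Q : MarkedPerm, Q.size = k ∧
      (∀ x < k, f (a + x) = c + Q.fn x) ∧
      ∀ o, o ∈ Q.marks ↔ o.pos < k ∧ shift a c o ∈ M := by
  obtain ⟨π, hπ⟩ := exists_perm k (fun x => f (a + x) - c) (fun x hx => by have := h x hx; omega)
    fun x hx y hy e => by
      have h1 := h x hx
      have h2 := h y hy
      have := hf (show f (a + x) = f (a + y) by omega)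
      omega
  refine ⟨⟨k, π, (M.preimage (shift a c) (shift_injective a c).injOn).filter fun o => o.pos < k⟩,
    rfl, fun x hx => ?_, fun o => ?_⟩
  · change _ = c + extend π x
    rw [hπ x hx]
    have := h x hx
    omega
  · rw [mem_filter, mem_preimage, and_comm]

/-- Every marked involution is an inflation: its blocks are the intervals between consecutive
cuts. -/
theorem IsInv.exists_skeleton (h : P.IsInv T) :
    ∃ q : Skeleton, q.Valid T ∧ IsInflation q P := by
  obtain ⟨s, h0, hmono, hs⟩ := h.marked.exists_starts
  obtain ⟨r, hinv, hk, himg⟩ := h.exists_block_perm h0 hmono hs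
  have hlt : ∀ i, s i < s (i + 1) := fun i => hmono (Nat.lt_succ_self i)
  have hcut : ∀ i, P.Cut (s i) := fun i => (hs _).2 ⟨i, rfl⟩
  obtain ⟨m, hm⟩ := (hs P.size).1 (h.marked.cut_of_le le_rfl)
  -- beyond the end of `P`, everything is a cut and a fixed point
  have hge : ∀ i, m ≤ i → s (i + 1) = s i + 1 ∧ r i = i := by
    intro i hi
    have hi' := hmono.monotone hi
    constructor
    · obtain ⟨j, hj⟩ := (hs (s i + 1)).1 (h.marked.cut_of_le (by omega))
      have h1 : i < j := hmono.lt_iff_lt.1 (by omega)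
      have h2 := hmono.monotone (show i + 1 ≤ j from h1)
      have h3 := hlt i
      omega
    · have h1 := himg i 0 (hlt i)
      rw [add_zero, P.fn_of_le (by omega)] at h1
      exact between_unique hmono h1.1 h1.2 le_rfl (hlt i)
  have hrlt : ∀ i < m, r i < m := by
    intro i hi
    by_contra! hri
    have := (hge _ hri).2
    rw [hinv] at this
    omega
  obtain ⟨ρ, hρ⟩ := exists_perm m r hrlt fun x _ y _ e => by rw [← hinv x, e, hinv]
  have hρr : ∀ i, extend ρ i = r i := by
    intro i
    by_cases hi : i < m
    · exact hρ i hi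
    · rw [extend_of_le _ (by omega), (hge i (by omega)).2]
  choose B hB1 hB2 hB3 using fun i => exists_restriction P.fn (extend_injective _) P.marks
    (a := s i) (c := s (r i)) (k := s (i + 1) - s i) fun x hx => by
      have h1 := himg i x (by omega)
      have h2 := hk i
      have h3 := hlt (r i)
      omega
  let q : Skeleton := ⟨m, ρ, fun i => B i⟩
  have hqB : ∀ i < m, q.block i = B i := fun i hi => q.block_of_lt hi
  have hsize : ∀ i, (q.block i).size = s (i + 1) - s i := by
    intro i
    by_cases hi : i < m
    · rw [hqB i hi, hB1]
    · rw [q.block_of_le (by simpa [q] using hi), (hge i (by omega)).1]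
      simp [point, MarkedPerm.size]
  have hstart : ∀ i, q.start i = s i := by
    intro i
    induction i with
    | zero => rw [q.start_zero, h0]
    | succ i ih => rw [q.start_succ, ih, hsize]; have := hlt i; omega
  have hperm : ∀ i, q.perm i = r i := hρr
  -- a mark meeting a block is contained in it, and comes from a mark of the block
  have hmark : ∀ i o, o ∈ P.marks → s i < o.pos + o.len → o.pos < s (i + 1) →
      ∃ o', o = shift (s i) (s (r i)) o' ∧ o' ∈ (B i).marks ∧
        o'.pos + o'.len ≤ s (i + 1) - s i ∧ o'.val < s (i + 1) - s i := by
    intro i o ho h1 h2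
    obtain ⟨τ, -, hτ⟩ := h.marked o ho
    have h3 := hcut i o ho
    have h4 := hcut (i + 1) o ho
    have h5 : s (r i) ≤ o.val ∨ o.val + o.len ≤ s (r i) := hcut (r i) _ (h.sibling_mem ho)
    have h6 : s (r i + 1) ≤ o.val ∨ o.val + o.len ≤ s (r i + 1) :=
      hcut (r i + 1) _ (h.sibling_mem ho)
    have h7 := hτ.two_le
    have h8 := hτ.mapsTo (x := o.pos) le_rfl (by omega)
    have h9 := himg i (o.pos - s i) (by omega)
    rw [Nat.add_sub_cancel' (by omega)] at h9
    have h10 := hk i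
    have e : o = shift (s i) (s (r i)) (o.pos - s i, o.val - s (r i), o.len) := by
      obtain ⟨p, v, l⟩ := o
      simp only [shift, Occ.pos, Occ.val, Occ.len, Prod.mk.injEq, and_true] at *
      omega
    refine ⟨_, e, (hB3 i _).2 ⟨?_, e ▸ ho⟩, ?_, ?_⟩ <;>
      simp only [Occ.pos, Occ.val, Occ.len] at * <;> omega
  have hinside : ∀ i o, o ∈ (B i).marks → o.pos + o.len ≤ s (i + 1) - s i ∧
      o.val < s (i + 1) - s i := by
    intro i o ho
    obtain ⟨h1, h2⟩ := (hB3 i o).1 ho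
    obtain ⟨τ, -, hτ⟩ := h.marked _ h2
    have h3 := hτ.two_le
    obtain ⟨o', e, h4, h5⟩ := hmark i _ h2
      (by simp only [shift, Occ.pos, Occ.val, Occ.len] at *; omega)
      (by simp only [shift, Occ.pos, Occ.val, Occ.len] at *; omega)
    rwa [shift_injective _ _ e]
  have hind : ∀ i, (B i).Indecomposable T := by
    intro i
    refine ⟨by rw [hB1]; have := hlt i; omega, fun o ho => ?_, fun x hx0 hx hxcut => ?_⟩
    · obtain ⟨h1, h2⟩ := (hB3 i o).1 ho
      obtain ⟨τ, hτ, h3, h4, h5⟩ := h.marked _ h2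
      have h6 := (hinside i o ho).1
      refine ⟨τ, hτ, h3, by rw [hB1]; exact h6, fun j => ?_⟩
      have h7 : P.fn (o.pos + s i + j) = τ.perm j + (o.val + s (r i)) := h5 j
      have h3 : o.len = τ.size := h3
      have h8 := hB2 i (o.pos + j) (by have := j.isLt; omega)
      rw [show s i + (o.pos + j) = o.pos + s i + j by omega, h7] at h8
      omega
    · rw [hB1] at hx
      obtain ⟨j, hj⟩ := (hs (s i + x)).1 fun o ho => by
        by_contra! hc
        obtain ⟨o', rfl, ho', -⟩ := hmark i o ho (by omega) (by omega)
        have := hxcut o' ho'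
        simp only [shift, Occ.pos, Occ.val, Occ.len] at *
        omega
      have h1 : i < j := hmono.lt_iff_lt.1 (by omega)
      have h2 : j < i + 1 := hmono.lt_iff_lt.1 (by omega)
      omega
  have hinvB : ∀ i, B (r i) = (B i).inv := by
    intro i
    refine MarkedPerm.inv_eq_iff (by rw [hB1, hB1, hk]) (fun x => ?_) fun o => ?_
    · by_cases hx : x < s (i + 1) - s i
      · have h1 : (B i).fn x < (B i).size := (B i).fn_lt (by rw [hB1]; exact hx)
        rw [hB1, ← hk] at h1
        have h2 := hB2 (r i) _ h1
        rw [← hB2 i x hx, h.fn_fn, hinv] at h2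
        omega
      · have h1 : (B i).fn x = x := (B i).fn_of_le (by rw [hB1]; omega)
        rw [h1]
        exact (B (r i)).fn_of_le (by rw [hB1, hk]; omega)
    · have key : ∀ i o, o ∈ (B i).marks → sibling o ∈ (B (r i)).marks := by
        intro i o ho
        have h1 := (hinside i o ho).2
        have h2 := h.sibling_mem ((hB3 i o).1 ho).2
        rw [hB3, hk, hinv]
        exact ⟨h1, h2⟩
      refine ⟨fun ho => ?_, key i (sibling o)⟩
      have := key _ _ ho
      rwa [hinv] at this
  refine ⟨q, ⟨?_, fun i => hind i, fun i => ?_⟩, ⟨?_, fun i x hx => ?_, fun o => ?_⟩⟩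
  · refine inv_eq_of_mul_eq_one_left ?_
    ext i
    change ((ρ (ρ i) : Fin m) : ℕ) = i
    rw [← extend_val, ← extend_val, hρr, hρr, hinv]
  · change B (ρ i : Fin m) = (B i).inv
    rw [← extend_val, hρr, hinvB]
  · rw [hstart]; exact hm
  · rw [hstart, hstart, hperm]
    by_cases hi : i < m
    · rw [hqB i hi]
      refine hB2 i x ?_
      rwa [hsize] at hx
    · have h1 := hge i (by omega)
      have h2 := hmono.monotone (show m ≤ i by omega)
      rw [hsize, h1.1] at hx
      obtain rfl : x = 0 := by omega
      rw [q.block_of_le (by simpa [q] using hi), h1.2, P.fn_of_le (by omega)]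
      rfl
  · constructor
    · intro ho
      obtain ⟨i, h1, h2⟩ := exists_between h0 hmono o.pos
      obtain ⟨τ, -, hτ⟩ := h.marked o ho
      have h3 := hτ.two_le
      have h4 := hτ.2.1
      obtain ⟨o', e, ho', -⟩ := hmark i o ho (by omega) h2
      have hi : i < m := hmono.lt_iff_lt.1 (by omega)
      refine ⟨i, o', by rwa [hqB i hi], ?_⟩
      rw [hstart, hstart, hperm, e]
    · rintro ⟨i, o', ho', rfl⟩
      rw [hstart, hstart, hperm]
      by_cases hi : i < m
      · rw [hqB i hi] at ho'
        exact ((hB3 i o').1 ho').2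
      · rw [q.block_of_le (by simpa [q] using hi)] at ho'
        exact absurd ho' (notMem_empty _)

end MarkedPerm

/-! ### Products over sets with an involution -/

section Involution

variable {α R : Type*} [CommRing R]

/-- A product over a set closed under an involution `e` runs over the orbits of `e`; the predicate
`L` selects a representative of each orbit of size two. -/
@[to_additive]
theorem prod_eq_prod_orbits [DecidableEq α] {N : Type*} [CommMonoid N] {M : Finset α} {e : α → α}
    (he : ∀ o, e (e o) = o) (hM : ∀ o ∈ M, e o ∈ M) (L : α → Prop) [DecidablePred L]
    (hL : ∀ o, e o ≠ o → (L (e o) ↔ ¬ L o)) (g : α → N) :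
    ∏ o ∈ M, g o = ∏ o ∈ M, if e o = o then g o else if L o then g o * g (e o) else 1 := by
  have h1 : ∀ o, (if e o = o then g o else if L o then g o * g (e o) else 1) =
      (if e o = o ∨ L o then g o else 1) * if e o ≠ o ∧ L o then g (e o) else 1 := by
    intro o
    by_cases h : e o = o <;> by_cases h' : L o <;> simp [h, h']
  have h2 : (∏ o ∈ M, if e o ≠ o ∧ L o then g (e o) else 1) =
      ∏ o ∈ M, if e o ≠ o ∧ ¬ L o then g o else 1 := by
    refine prod_nbij' e e hM hM (fun o _ => he o) (fun o _ => he o) fun o _ => ?_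
    by_cases h : e o = o
    · simp [h]
    · have := hL o h
      have h' : ¬ o = e o := fun h' => h h'.symm
      simp [he, h, h', this]
  simp_rw [h1]
  rw [prod_mul_distrib, h2, ← prod_mul_distrib]
  refine prod_congr rfl fun o _ => ?_
  by_cases h : e o = o <;> by_cases h' : L o <;> simp [h, h']

/-- Expansion of a product over a set closed under an involution, with a factor `1 + φ(o)` for each
fixed point `o` and `1 + φ(o) φ(e o)` for each orbit `{o, e o}`. -/
theorem prod_eq_sum_closed [DecidableEq α] {O : Finset α} {e : α → α} (he : ∀ o, e (e o) = o)
    (hO : ∀ o ∈ O, e o ∈ O) (L : α → Prop) (hL : ∀ o, e o ≠ o → (L (e o) ↔ ¬ L o)) (v φ : α → R)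
    (h1 : ∀ o ∈ O, e o = o → v o = 1 + φ o)
    (h2 : ∀ o ∈ O, e o ≠ o → v o * v (e o) = 1 + φ o * φ (e o)) :
    ∏ o ∈ O, v o = ∑ M ∈ O.powerset with M.image e = M, ∏ o ∈ M, φ o := by
  -- one representative of each orbit
  let rep : α → Prop := fun o => e o = o ∨ L o
  have hrep : ∀ o, ¬ rep o → rep (e o) := fun o h => by
    simp only [rep, not_or] at h
    exact .inr ((hL o h.1).2 h.2)
  have hrep' : ∀ o, rep o → rep (e o) → e o = o := fun o h h' => by
    by_contra hne
    rcases h with h | h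
    · exact hne h
    · rcases h' with h' | h'
      · rw [he] at h'; exact hne h'.symm
      · exact (hL o hne).1 h' h
  have split : ∀ (M : Finset α) (_ : ∀ o ∈ M, e o ∈ M) (g : α → R), ∏ o ∈ M, g o =
      ∏ o ∈ M with rep o, if e o = o then g o else g o * g (e o) := by
    intro M hM g
    rw [prod_eq_prod_orbits he hM L hL, prod_filter]
    refine prod_congr rfl fun o _ => ?_
    by_cases h : e o = o <;> by_cases h' : L o <;> simp [rep, h, h']
  rw [split O hO]
  have h3 : ∀ o ∈ O.filter rep, (if e o = o then v o else v o * v (e o)) =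
      1 + if e o = o then φ o else φ o * φ (e o) := by
    intro o ho
    have ho := (mem_filter.1 ho).1
    split_ifs with h
    · exact h1 o ho h
    · exact h2 o ho h
  rw [prod_congr rfl h3, prod_one_add]
  have closed : ∀ M : Finset α, M.image e = M ↔ ∀ o ∈ M, e o ∈ M := by
    intro M
    constructor
    · intro h o ho
      rw [← h]; exact mem_image_of_mem _ ho
    · intro h
      refine Subset.antisymm (image_subset_iff.2 h) fun o ho => ?_
      exact mem_image.2 ⟨e o, h o ho, he o⟩
  refine sum_nbij' (fun S => S ∪ S.image e) (fun M => M.filter rep) ?_ ?_ ?_ ?_ ?_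
  · intro S hS
    rw [mem_powerset] at hS
    have hSO : S ⊆ O := hS.trans (filter_subset _ _)
    rw [mem_filter, mem_powerset, closed]
    refine ⟨union_subset hSO (image_subset_iff.2 fun o ho => hO o (hSO ho)), fun o ho => ?_⟩
    rw [mem_union, mem_image] at ho ⊢
    rcases ho with ho | ⟨o', ho', rfl⟩
    · exact .inr ⟨o, ho, rfl⟩
    · rw [he]; exact .inl ho'
  · intro M hM
    rw [mem_filter, mem_powerset] at hM
    exact mem_powerset.2 (filter_subset_filter _ hM.1)
  · intro S hS
    rw [mem_powerset] at hS
    ext o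
    simp only [mem_filter, mem_union, mem_image]
    constructor
    · rintro ⟨ho | ⟨o', ho', rfl⟩, h⟩
      · exact ho
      · rwa [hrep' o' (mem_filter.1 (hS ho')).2 h]
    · exact fun ho => ⟨.inl ho, (mem_filter.1 (hS ho)).2⟩
  · intro M hM
    rw [mem_filter, closed] at hM
    ext o
    simp only [mem_filter, mem_union, mem_image]
    constructor
    · rintro (⟨ho, -⟩ | ⟨o', ⟨ho', -⟩, rfl⟩)
      · exact ho
      · exact hM.2 o' ho'
    · intro ho
      by_cases h : rep o
      · exact .inl ⟨ho, h⟩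
      · exact .inr ⟨e o, ⟨hM.2 o ho, hrep o h⟩, he o⟩
  · intro S hS
    rw [mem_powerset] at hS
    have hcl : ∀ o ∈ S ∪ S.image e, e o ∈ S ∪ S.image e := by
      intro o ho
      rw [mem_union, mem_image] at ho ⊢
      rcases ho with ho | ⟨o', ho', rfl⟩
      · exact .inr ⟨o, ho, rfl⟩
      · rw [he]; exact .inl ho'
    rw [split _ hcl]
    refine prod_congr ?_ fun _ _ => rfl
    ext o
    simp only [mem_filter, mem_union, mem_image]
    constructor
    · exact fun ho => ⟨.inl ho, (mem_filter.1 (hS ho)).2⟩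
    · rintro ⟨ho | ⟨o', ho', rfl⟩, h⟩
      · exact ho
      · rwa [hrep' o' (mem_filter.1 (hS ho')).2 h]

/-- A product over patterns of powers with numbers of occurrences as exponents is a product over
the occurrences. -/
theorem finprod_mem_pow_card {κ : Type*} (M : Finset α) (S : Set κ) (g : κ → R) (p : α → κ)
    (c : α → Prop) (A : κ → α → Prop) [∀ τ, DecidablePred (A τ)]
    (hA : ∀ o ∈ M, ∀ τ, A τ o ↔ p o = τ ∧ c o) :
    ∏ᶠ τ ∈ S, g τ ^ #{o ∈ M | A τ o} = ∏ o ∈ M, if p o ∈ S ∧ c o then g (p o) else 1 := by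
  have hcard : ∀ τ, {o ∈ M | A τ o} = {o ∈ M | p o = τ ∧ c o} := fun τ =>
    filter_congr fun o ho => hA o ho τ
  rw [finprod_mem_def, finprod_eq_prod_of_mulSupport_subset (s := M.image p)]
  · rw [← prod_fiberwise_of_maps_to (g := p) (t := M.image p) fun o ho => mem_image_of_mem p ho]
    refine prod_congr rfl fun τ _ => ?_
    rw [Set.mulIndicator_apply, hcard, ← filter_filter, ← prod_const, prod_filter]
    split_ifs with hτ
    · refine prod_congr rfl fun o ho => ?_
      rw [(mem_filter.1 ho).2]
      simp [hτ]
    · symm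
      refine prod_eq_one fun o ho => ?_
      rw [(mem_filter.1 ho).2]
      simp [hτ]
  · intro τ hτ
    rw [Function.mem_mulSupport, Set.mulIndicator_apply] at hτ
    by_contra h
    refine hτ ?_
    rw [hcard, filter_false_of_mem, card_empty, pow_zero, ite_self]
    rintro o ho ⟨rfl, -⟩
    exact h (mem_coe.2 (mem_image_of_mem p ho))

end Involution

/-! ### Weights -/

/-- The pattern of the occurrence at a location (arbitrary if there is none). -/
noncomputable def pat (f : ℕ → ℕ) (o : Occ) : HPattern :=
  if h : ∃ τ n, IsOccFn τ f n o then h.choose else ⟨2, le_rfl, 1⟩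

theorem IsOccFn.pat_eq {τ : HPattern} {f : ℕ → ℕ} {n : ℕ} {o : Occ} (h : IsOccFn τ f n o) :
    pat f o = τ := by
  have hex : ∃ τ n, IsOccFn τ f n o := ⟨τ, n, h⟩
  rw [pat, dif_pos hex]
  exact hex.choose_spec.choose_spec.unique h

section Weights

variable {R : Type*} [CommRing R] (T TL : Set HPattern)

/-- The factor that an occurrence of `τ` contributes to the weight of a marked involution; `self`
says whether the occurrence coincides with its sibling. -/
noncomputable def markWeight (u v w : HPattern → R) (self : Prop) (τ : HPattern) : R :=
  (if τ ∈ involutive T ∧ self then u τ else 1) * (if τ ∈ involutive T ∧ ¬ self then v τ else 1) *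
    if τ ∈ TL then w τ else 1

variable {T TL}

theorem mem_involutive_inv {τ : HPattern} (h : τ ∈ involutive T) : τ.inv = τ :=
  HPattern.isInvolution_iff.1 h.2

theorem inv_mem_involutive {τ : HPattern} : τ.inv ∈ involutive T ↔ τ ∈ involutive T := by
  constructor
  · intro h
    have := mem_involutive_inv h
    rw [τ.inv_inv] at this
    rwa [this]
  · intro h
    rwa [mem_involutive_inv h]

theorem IsHalf.not_mem_involutive (h : IsHalf T TL) {τ : HPattern} (hτ : τ ∈ TL) :
    τ ∉ involutive T := by
  have : τ ∈ T \ involutive T := h.1 ▸ Or.inl hτ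
  exact this.2

theorem IsHalf.inv_not_mem (h : IsHalf T TL) {τ : HPattern} (hτ : τ ∈ TL) : τ.inv ∉ TL :=
  fun h' => Set.disjoint_left.1 h.2 hτ ⟨τ.inv, h', τ.inv_inv⟩

theorem IsHalf.cases (h : IsHalf T TL) {τ : HPattern} (hτ : τ ∈ T) :
    τ ∈ involutive T ∨ τ ∈ TL ∨ τ.inv ∈ TL := by
  by_cases h1 : τ ∈ involutive T
  · exact .inl h1
  · have : τ ∈ TL ∪ HPattern.inv '' TL := h.1 ▸ ⟨hτ, h1⟩
    rcases this with h2 | ⟨σ, h2, rfl⟩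
    · exact .inr (.inl h2)
    · exact .inr (.inr h2)

/-- An occurrence that coincides with its sibling is one of a pattern in `T_I`. -/
theorem markWeight_self (h : IsHalf T TL) (u v v' w : HPattern → R) {τ : HPattern} (hτ : τ ∈ T)
    (hinv : τ.inv = τ) : markWeight T TL u v w True τ =
      1 + markWeight T TL (fun τ => u τ - 1) v' (fun τ => w τ - 1) True τ := by
  have h1 : τ ∈ involutive T := ⟨hτ, HPattern.isInvolution_iff.2 hinv⟩
  have h2 : τ ∉ TL := fun h' => h.not_mem_involutive h' h1
  simp [markWeight, h1, h2]

/-- The factor of a pair of distinct siblings. -/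
theorem markWeight_mul_inv (u v w : HPattern → R) (τ : HPattern) :
    markWeight T TL u v w False τ * markWeight T TL u v w False τ.inv =
      (if τ ∈ involutive T then v τ ^ 2 else 1) * (if τ ∈ TL then w τ else 1) *
        if τ.inv ∈ TL then w τ.inv else 1 := by
  by_cases h1 : τ ∈ involutive T
  · have h2 := mem_involutive_inv h1
    simp only [markWeight, h1, h2, and_false, not_false_eq_true, and_true, if_true, if_false]
    ring
  · have h2 : τ.inv ∉ involutive T := fun h => h1 (inv_mem_involutive.1 h)
    simp only [markWeight, h1, h2, false_and, if_false]
    ring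

theorem markWeight_pair (h : IsHalf T TL) (u u' v v' w : HPattern → R)
    (hs : ∀ τ ∈ involutive T, v' τ ^ 2 = v τ ^ 2 - 1) {τ : HPattern} (hτ : τ ∈ T) :
    markWeight T TL u v w False τ * markWeight T TL u v w False τ.inv =
      1 + markWeight T TL u' v' (fun τ => w τ - 1) False τ *
        markWeight T TL u' v' (fun τ => w τ - 1) False τ.inv := by
  rw [markWeight_mul_inv, markWeight_mul_inv]
  rcases h.cases hτ with h1 | h1 | h1
  · have h2 : τ ∉ TL := fun h' => h.not_mem_involutive h' h1
    simp [h1, h2, mem_involutive_inv h1, hs τ h1]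
  · simp [h1, h.not_mem_involutive h1, h.inv_not_mem h1]
  · have h2 : τ ∉ involutive T := fun h' => h.not_mem_involutive h1 (inv_mem_involutive.2 h')
    have h3 : τ ∉ TL := fun h' => h.inv_not_mem h' h1
    simp [h1, h2, h3]

namespace MarkedPerm

variable (T TL)

/-- The weight of a marked involution, without the power of `x`. -/
noncomputable def invWeight (t : R) (u v w : HPattern → R) (P : MarkedPerm) : R :=
  (∏ x ∈ range P.size, if P.fn x = x then t else 1) *
    ∏ o ∈ P.marks, markWeight T TL u v w (sibling o = o) (pat P.fn o)

/-- The weight of a block that is not fixed in a marked involution. -/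
noncomputable def movedWeight (u v w : HPattern → R) (P : MarkedPerm) : R :=
  ∏ o ∈ P.marks, markWeight T TL u v w False (pat P.fn o)

/-- The weight of a marked permutation in the cluster generating function, without the power
of `x`. -/
noncomputable def clusterWeight (a b c : HPattern → R) (P : MarkedPerm) : R :=
  ∏ o ∈ P.marks, (if pat P.fn o ∈ involutive T then a (pat P.fn o) else 1) *
    (if pat P.fn o ∈ TL then b (pat P.fn o) else 1) *
      if (pat P.fn o).inv ∈ TL then c (pat P.fn o).inv else 1

variable {T TL}

theorem Marked.isOcc_iff {P : MarkedPerm} (h : P.Marked T) {o : Occ} (ho : o ∈ P.marks)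
    (τ : HPattern) : IsOcc τ P.2.1 o ↔ pat P.fn o = τ := by
  obtain ⟨σ, -, hσ⟩ := h o ho
  rw [hσ.pat_eq, Hertzsprung.isOcc_iff]
  exact ⟨fun h => hσ.unique h, fun h => h ▸ hσ⟩

theorem Marked.pat_mem {P : MarkedPerm} (h : P.Marked T) {o : Occ} (ho : o ∈ P.marks) :
    pat P.fn o ∈ T := by
  obtain ⟨σ, h1, hσ⟩ := h o ho
  rwa [hσ.pat_eq]

theorem Marked.pat_sibling {P : MarkedPerm} (h : P.Marked T) {o : Occ} (ho : o ∈ P.marks) :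
    pat P.inv.fn (sibling o) = (pat P.fn o).inv := by
  obtain ⟨σ, -, hσ⟩ := h o ho
  rw [hσ.pat_eq]
  exact hσ.sibling.pat_eq

theorem pow_fp {n : ℕ} (t : R) (π : Equiv.Perm (Fin n)) :
    t ^ fp π = ∏ x ∈ range n, if extend π x = x then t else 1 := by
  rw [prod_range, fp, ← prod_const, prod_filter]
  refine prod_congr rfl fun i _ => ?_
  simp only [extend_val, Fin.ext_iff]

theorem Marked.invWeight_eq {P : MarkedPerm} (h : P.Marked T) (t : R) (u v w : HPattern → R) :
    t ^ fp P.2.1 *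
      (∏ᶠ τ ∈ involutive T, u τ ^ sibCount τ P.2.1 P.2.2) *
      (∏ᶠ τ ∈ involutive T, v τ ^ nsibCount τ P.2.1 P.2.2) *
      (∏ᶠ σ ∈ TL, w σ ^ occCount σ P.2.1 P.2.2) = P.invWeight T TL t u v w := by
  unfold sibCount nsibCount occCount
  rw [finprod_mem_pow_card P.2.2 _ u (pat P.fn) (fun o => sibling o = o) _ fun o ho τ => by
      rw [h.isOcc_iff ho],
    finprod_mem_pow_card P.2.2 _ v (pat P.fn) (fun o => sibling o ≠ o) _ fun o ho τ => by
      rw [h.isOcc_iff ho],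
    finprod_mem_pow_card P.2.2 _ w (pat P.fn) (fun _ => True) _ fun o ho τ => by
      rw [h.isOcc_iff ho, and_true],
    invWeight, pow_fp, mul_assoc, mul_assoc, ← prod_mul_distrib, ← prod_mul_distrib]
  congr 1
  refine prod_congr rfl fun o _ => ?_
  by_cases h : sibling o = o <;> simp [markWeight, h]

theorem Marked.clusterWeight_eq {P : MarkedPerm} (h : P.Marked T) (a b c : HPattern → R) :
    (∏ᶠ τ ∈ involutive T, a τ ^ occCount τ P.2.1 P.2.2) *
      (∏ᶠ σ ∈ TL, b σ ^ occCount σ P.2.1 P.2.2) *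
      (∏ᶠ σ ∈ TL, c σ ^ occCount σ.inv P.2.1 P.2.2) = P.clusterWeight T TL a b c := by
  unfold occCount
  rw [finprod_mem_pow_card P.2.2 _ a (pat P.fn) (fun _ => True) _ fun o ho τ => by
      rw [h.isOcc_iff ho, and_true],
    finprod_mem_pow_card P.2.2 _ b (pat P.fn) (fun _ => True) _ fun o ho τ => by
      rw [h.isOcc_iff ho, and_true],
    finprod_mem_pow_card P.2.2 _ c (fun o => (pat P.fn o).inv) (fun _ => True) _ fun o ho τ => by
      rw [h.isOcc_iff ho, and_true]
      constructor
      · intro h; rw [h, τ.inv_inv]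
      · intro h; rw [← h, HPattern.inv_inv],
    clusterWeight, ← prod_mul_distrib, ← prod_mul_distrib]
  simp only [and_true]

/-- The blocks of a 2-cycle are inverse to each other, and their marks are paired as siblings. -/
theorem Marked.movedWeight_mul_inv {P : MarkedPerm} (h : P.Marked T) (u v w a : HPattern → R)
    (ha : ∀ τ ∈ involutive T, v τ ^ 2 = a τ) :
    P.movedWeight T TL u v w * P.inv.movedWeight T TL u v w = P.clusterWeight T TL a w w := by
  unfold movedWeight clusterWeight
  rw [show P.inv.marks = P.marks.image sibling from rfl,
    prod_image fun _ _ _ _ e => sibling_injective e, ← prod_mul_distrib]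
  refine prod_congr rfl fun o ho => ?_
  rw [h.pat_sibling ho, markWeight_mul_inv]
  congr 2
  split_ifs with h1
  · exact ha _ h1
  · rfl

/-- Expansion of the weight of an involution over its sibling-closed sets of marks. -/
theorem invWeight_occurrences (hinv : IsSelfInverse T) (hT : IsHalf T TL)
    {n : ℕ} {π : Equiv.Perm (Fin n)}
    (hπ : π⁻¹ = π) (t : R) (u v v' w : HPattern → R)
    (hs : ∀ τ ∈ involutive T, v' τ ^ 2 = v τ ^ 2 - 1) :
    invWeight T TL t u v w ⟨n, π, occurrences T π⟩ =
      ∑ M ∈ (occurrences T π).powerset with M.image sibling = M,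
        invWeight T TL t (fun τ => u τ - 1) v' (fun τ => w τ - 1) ⟨n, π, M⟩ := by
  have key : ∀ (u v w : HPattern → R) (M : Finset Occ), invWeight T TL t u v w ⟨n, π, M⟩ =
      (∏ x ∈ range n, if extend π x = x then t else 1) *
        ∏ o ∈ M, markWeight T TL u v w (sibling o = o) (pat (extend π) o) := fun _ _ _ _ => rfl
  simp only [key]
  rw [← mul_sum]
  congr 1
  have hm : Marked T ⟨n, π, occurrences T π⟩ := marked_iff.2 (Subset.refl _)
  have hsib : ∀ o ∈ occurrences T π, pat (extend π) (sibling o) = (pat (extend π) o).inv := by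
    intro o ho
    have : pat (extend π⁻¹) (sibling o) = (pat (extend π) o).inv := hm.pat_sibling ho
    rwa [hπ] at this
  refine prod_eq_sum_closed (R := R) sibling_sibling (fun o ho => ?_) (fun o => o.pos < o.val)
    (fun o ho => ?_) _ _ (fun o ho h => ?_) fun o ho h => ?_
  · obtain ⟨τ, h1, h2⟩ := hm.inv hinv (sibling o) (mem_marks_inv.2 ho)
    refine mem_occurrences.2 ⟨τ, h1, isOcc_iff.2 ?_⟩
    rwa [← hπ]
  · rw [Ne, sibling_eq_self] at ho
    simp only [sibling, Occ.pos, Occ.val] at ho ⊢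
    omega
  · simp only [h]
    refine markWeight_self hT u v v' w (hm.pat_mem ho) ?_
    have := hsib o ho
    rw [h] at this
    exact this.symm
  · have h' : ¬ sibling (sibling o) = sibling o := fun e => h e.symm
    change markWeight _ _ _ _ _ _ (pat (extend π) o) *
      markWeight _ _ _ _ _ _ (pat (extend π) (sibling o)) = 1 +
      markWeight _ _ _ _ _ _ (pat (extend π) o) *
      markWeight _ _ _ _ _ _ (pat (extend π) (sibling o))
    rw [hsib o ho]
    simp only [h, h']
    exact markWeight_pair hT _ _ _ _ _ hs (hm.pat_mem ho)

end MarkedPerm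
end Weights

/-! ### The weight of an inflation -/

theorem Skeleton.sum_size (q : Skeleton) : q.start q.1 = ∑ i, (q.2.2 i).size := by
  rw [start, sum_range]
  simp only [block_val]

section

variable {R : Type*} [CommRing R] {T TL : Set HPattern} {q : Skeleton} {P : MarkedPerm}

theorem Skeleton.prod_range_start {N : Type*} [CommMonoid N] (q : Skeleton) (h : ℕ → N) (m : ℕ) :
    ∏ x ∈ range (q.start m), h x =
      ∏ i ∈ range m, ∏ y ∈ range (q.block i).size, h (q.start i + y) := by
  induction m with
  | zero => simp [q.start_zero]
  | succ m ih => rw [prod_range_succ, ← ih, q.start_succ, prod_range_add]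

namespace IsInflation

theorem marks_eq (h : IsInflation q P) : P.marks = (range q.1).biUnion fun i =>
    (q.block i).marks.image (shift (q.start i) (q.start (q.perm i))) := by
  ext o
  simp only [mem_biUnion, mem_range, mem_image, h.marks]
  constructor
  · rintro ⟨i, o', ho', rfl⟩
    refine ⟨i, ?_, o', ho', rfl⟩
    by_contra hi
    rw [q.block_of_le (by omega)] at ho'
    exact notMem_empty _ ho'
  · rintro ⟨i, -, o', ho', rfl⟩
    exact ⟨i, o', ho', rfl⟩

theorem prod_marks (hq : q.Valid T) (h : IsInflation q P) {N : Type*} [CommMonoid N]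
    (g : Occ → N) : ∏ o ∈ P.marks, g o =
      ∏ i ∈ range q.1, ∏ o ∈ (q.block i).marks, g (shift (q.start i) (q.start (q.perm i)) o) := by
  rw [h.marks_eq, prod_biUnion]
  · exact prod_congr rfl fun i _ => prod_image fun _ _ _ _ e => shift_injective _ _ e
  · intro i _ j _ hij
    refine disjoint_left.2 fun o hi hj => hij ?_
    obtain ⟨o₁, h1, rfl⟩ := mem_image.1 hi
    obtain ⟨o₂, h2, e⟩ := mem_image.1 hj
    have e' : o₂.pos + q.start j = o₁.pos + q.start i := congrArg Prod.fst e
    have h1 := (pos_lt (hq.block_indecomposable i).marked h1).1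
    have h2 := (pos_lt (hq.block_indecomposable j).marked h2).1
    exact (hq.eq_of_eq h1 h2 (by omega)).1

theorem pat_shift (hq : q.Valid T) (h : IsInflation q P) {i : ℕ} {o : Occ}
    (ho : o ∈ (q.block i).marks) :
    pat P.fn (shift (q.start i) (q.start (q.perm i)) o) = pat (q.block i).fn o := by
  obtain ⟨τ, -, hτ⟩ := (hq.block_indecomposable i).marked o ho
  rw [hτ.pat_eq]
  obtain ⟨h1, h2, h3⟩ := hτ
  refine IsOccFn.pat_eq (n := o.pos + q.start i + o.len) ⟨h1, le_rfl, fun j => ?_⟩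
  have h4 := h.fn i (o.pos + j) (by have := j.isLt; omega)
  rw [h3 j] at h4
  change P.fn (o.pos + q.start i + j) = τ.perm j + (o.val + q.start (q.perm i))
  rw [show o.pos + q.start i + j = q.start i + (o.pos + j) by omega, h4]
  omega

/-- A mark of an inflation coincides with its sibling only in a block fixed by the permutation of
the blocks. -/
theorem sibling_shift (hq : q.Valid T) {i : ℕ} {o : Occ} (ho : o ∈ (q.block i).marks) :
    sibling (shift (q.start i) (q.start (q.perm i)) o) =
        shift (q.start i) (q.start (q.perm i)) o ↔ q.perm i = i ∧ sibling o = o := by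
  rw [sibling_eq_self, sibling_eq_self]
  change o.pos + q.start i = o.val + q.start (q.perm i) ↔ _
  constructor
  · intro e
    have h1 := (pos_lt (hq.block_indecomposable i).marked ho).1
    have h2 := (pos_lt (hq.block_indecomposable (q.perm i)).marked
      (o := sibling o) (by rw [hq.block_perm, MarkedPerm.mem_marks_inv]; exact ho)).1
    have h3 := hq.eq_of_eq h1 h2 (by change _ = _ + o.val; omega)
    exact ⟨h3.1.symm, h3.2⟩
  · rintro ⟨h1, h2⟩
    rw [h1, h2]

theorem invWeight_eq (hq : q.Valid T) (h : IsInflation q P) (t : R) (u v w : HPattern → R) :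
    P.invWeight T TL t u v w = ∏ i : Fin q.1, if q.2.1 i = i
      then (q.2.2 i).invWeight T TL t u v w else (q.2.2 i).movedWeight T TL u v w := by
  rw [MarkedPerm.invWeight, ← h.size, q.prod_range_start, h.prod_marks hq, ← prod_mul_distrib,
    prod_range]
  refine prod_congr rfl fun i _ => ?_
  rw [← q.block_val]
  have hperm : q.2.1 i = i ↔ q.perm i = i := by rw [Fin.ext_iff, Skeleton.perm, extend_val]
  have hmarks : ∏ o ∈ (q.block i).marks, markWeight T TL u v w
      (sibling (shift (q.start i) (q.start (q.perm i)) o) =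
        shift (q.start i) (q.start (q.perm i)) o)
      (pat P.fn (shift (q.start i) (q.start (q.perm i)) o)) =
      ∏ o ∈ (q.block i).marks, markWeight T TL u v w (q.perm i = i ∧ sibling o = o)
        (pat (q.block i).fn o) :=
    prod_congr rfl fun o ho => by rw [h.pat_shift hq ho, propext (sibling_shift hq ho)]
  rw [hmarks]
  split_ifs with hi
  · rw [hperm] at hi
    rw [MarkedPerm.invWeight]
    congr 1
    · refine prod_congr rfl fun y hy => ?_
      rw [h.fn i y (mem_range.1 hy), hi]
      simp only [Nat.add_left_cancel_iff]
    · simp only [hi, true_and]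
  · rw [hperm] at hi
    rw [MarkedPerm.movedWeight, prod_eq_one, one_mul]
    · simp only [hi, false_and]
    · intro y hy
      rw [mem_range] at hy
      rw [h.fn i y hy, if_neg]
      intro e
      refine hi (hq.eq_of_eq ?_ hy e).1
      rw [hq.size_perm]
      exact MarkedPerm.fn_lt _ hy

/-- The blocks of a marked involution contribute the weights of involutory clusters and of clusters
to its weight. -/
theorem invWeight_eq_prod (hq : q.Valid T) (h : IsInflation q P) (t : R) (u v w a : HPattern → R)
    (ha : ∀ τ ∈ involutive T, v τ ^ 2 = a τ) :
    P.invWeight T TL t u v w = ∏ i : Fin q.1, if q.2.1 i = i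
      then (q.2.2 i).invWeight T TL t u v w
      else if i < q.2.1 i then (q.2.2 i).clusterWeight T TL a w w else 1 := by
  have hρ : ∀ i, q.2.1 (q.2.1 i) = i := fun i => by
    have := Equiv.symm_apply_apply q.2.1 i
    rwa [← Equiv.Perm.inv_def, hq.inv_perm] at this
  rw [h.invWeight_eq hq, prod_eq_prod_orbits (e := q.2.1) hρ (fun _ _ => mem_univ _)
    (fun i => i < q.2.1 i) fun i hi => by rw [hρ, not_lt]; exact ⟨le_of_lt, fun h' => h'.lt_of_ne hi⟩]
  refine prod_congr rfl fun i _ => ?_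
  by_cases hi : q.2.1 i = i
  · simp only [hi, if_true]
  · have hi' : ¬ i = q.2.1 i := fun e => hi e.symm
    simp only [hi, hi', hρ, if_false]
    refine if_congr Iff.rfl ?_ rfl
    rw [hq.inv_block, (hq.indecomposable i).marked.movedWeight_mul_inv u v w a ha]

end IsInflation

/-! ### The sum over all marked involutions -/

/-- The finite set of `T`-marked permutations of length `n`. -/
noncomputable def markedPerms (T : Set HPattern) (n : ℕ) : Finset MarkedPerm :=
  univ.biUnion fun π : Equiv.Perm (Fin n) =>
    (occurrences T π).powerset.image fun M => (⟨n, π, M⟩ : MarkedPerm)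

theorem mem_markedPerms {n : ℕ} : P ∈ markedPerms T n ↔ P.size = n ∧ P.Marked T := by
  simp only [markedPerms, mem_biUnion, mem_univ, true_and, mem_image, mem_powerset]
  constructor
  · rintro ⟨π, M, hM, rfl⟩
    exact ⟨rfl, MarkedPerm.marked_iff.2 hM⟩
  · obtain ⟨k, π, M⟩ := P
    rintro ⟨rfl, h⟩
    exact ⟨π, M, MarkedPerm.marked_iff.1 h, rfl⟩

theorem sum_markedPerms {N : Type*} [AddCommMonoid N] (T : Set HPattern) (n : ℕ)
    (p : MarkedPerm → Prop) [DecidablePred p] (F : MarkedPerm → N) :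
    ∑ P ∈ markedPerms T n with p P, F P =
      ∑ π : Equiv.Perm (Fin n), ∑ M ∈ (occurrences T π).powerset with p ⟨n, π, M⟩, F ⟨n, π, M⟩ := by
  rw [sum_filter, markedPerms, sum_biUnion]
  · refine sum_congr rfl fun π _ => ?_
    rw [sum_image, sum_filter]
    rintro M - M' - e
    simpa using e
  · rintro π - π' - hne
    refine disjoint_left.2 fun Q h1 h2 => hne ?_
    obtain ⟨M, -, rfl⟩ := mem_image.1 h1
    obtain ⟨M', -, e⟩ := mem_image.1 h2
    simp only [Sigma.mk.injEq, heq_eq_eq, Prod.mk.injEq, true_and] at e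
    exact e.1.symm

/-- The indecomposable marked permutations of length at most `n`. -/
noncomputable def indecomposables (T : Set HPattern) (n : ℕ) : Finset MarkedPerm :=
  (range (n + 1)).biUnion fun k => (markedPerms T k).filter fun P => P.Indecomposable T

theorem mem_indecomposables {n : ℕ} :
    P ∈ indecomposables T n ↔ P.Indecomposable T ∧ P.size ≤ n := by
  simp only [indecomposables, mem_biUnion, mem_range, mem_filter, mem_markedPerms]
  constructor
  · rintro ⟨k, hk, ⟨rfl, -⟩, h⟩
    exact ⟨h, by omega⟩
  · rintro ⟨h, hn⟩
    exact ⟨P.size, by omega, ⟨rfl, h.marked⟩, h⟩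

/-- The families of blocks, indexed by all positions, that turn `ρ` into a marked involution of
length `n`. -/
noncomputable def symmetricFamilies (T : Set HPattern) (n : ℕ) {m : ℕ} (ρ : Equiv.Perm (Fin m)) :
    Finset (Fin m → MarkedPerm) :=
  (Fintype.piFinset fun _ => indecomposables T n).filter fun b =>
    (∀ i, b (ρ i) = (b i).inv) ∧ ∑ i, (b i).size = n

theorem mem_symmetricFamilies {n m : ℕ} {ρ : Equiv.Perm (Fin m)} {b : Fin m → MarkedPerm} :
    b ∈ symmetricFamilies T n ρ ↔ (∀ i, (b i).Indecomposable T) ∧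
      (∀ i, b (ρ i) = (b i).inv) ∧ ∑ i, (b i).size = n := by
  simp only [symmetricFamilies, mem_filter, Fintype.mem_piFinset, mem_indecomposables]
  constructor
  · exact fun ⟨h1, h2⟩ => ⟨fun i => (h1 i).1, h2⟩
  · rintro ⟨h1, h2, h3⟩
    refine ⟨fun i => ⟨h1 i, ?_⟩, h2, h3⟩
    rw [← h3]
    exact single_le_sum (f := fun i => (b i).size) (fun _ _ => Nat.zero_le _) (mem_univ i)

/-- The weight of the block `B` at position `i` of an inflation of `ρ`, the blocks of a 2-cycle
being accounted for at its smaller element. -/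
noncomputable def blockWeight (T TL : Set HPattern) (t : R) (u v w a : HPattern → R) {m : ℕ}
    (ρ : Equiv.Perm (Fin m)) (i : Fin m) (B : MarkedPerm) : R :=
  if ρ i = i then B.invWeight T TL t u v w
  else if i < ρ i then B.clusterWeight T TL a w w else 1

/-- The bijection between marked involutions and inflation data, with weights. -/
theorem sum_isInv (T TL : Set HPattern) (n : ℕ) (t : R) (u v w a : HPattern → R)
    (ha : ∀ τ ∈ involutive T, v τ ^ 2 = a τ) :
    ∑ P ∈ markedPerms T n with P.inv = P, P.invWeight T TL t u v w =
      ∑ m ∈ range (n + 1), ∑ ρ : Equiv.Perm (Fin m) with ρ⁻¹ = ρ,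
        ∑ b ∈ symmetricFamilies T n ρ, ∏ i, blockWeight T TL t u v w a ρ i (b i) := by
  let S : Finset Skeleton := (range (n + 1)).sigma fun m =>
    (univ.filter fun ρ : Equiv.Perm (Fin m) => ρ⁻¹ = ρ).biUnion fun ρ =>
      (symmetricFamilies T n ρ).image fun b => (ρ, b)
  have hS : ∀ q, q ∈ S ↔ q.Valid T ∧ q.start q.1 = n := by
    rintro ⟨m, ρ, b⟩
    simp only [S, mem_sigma, mem_range, mem_biUnion, mem_filter, mem_univ, true_and, mem_image,
      mem_symmetricFamilies, Prod.mk.injEq]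
    have hst : Skeleton.start ⟨m, ρ, b⟩ m = ∑ i, (b i).size := Skeleton.sum_size ⟨m, ρ, b⟩
    rw [hst]
    constructor
    · rintro ⟨-, ρ, h1, b, ⟨h2, h3, h4⟩, rfl, rfl⟩
      exact ⟨⟨h1, h2, h3⟩, h4⟩
    · rintro ⟨⟨h1, h2, h3⟩, h4⟩
      refine ⟨?_, ρ, h1, b, ⟨h2, h3, h4⟩, rfl, rfl⟩
      have : ∑ _i : Fin m, 1 ≤ ∑ i, (b i).size := sum_le_sum fun i _ => (h2 i).pos
      simp only [sum_const, card_univ, Fintype.card_fin, smul_eq_mul, mul_one] at this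
      omega
  have hsum : ∑ m ∈ range (n + 1), ∑ ρ : Equiv.Perm (Fin m) with ρ⁻¹ = ρ,
        ∑ b ∈ symmetricFamilies T n ρ, ∏ i, blockWeight T TL t u v w a ρ i (b i) =
      ∑ q ∈ S, ∏ i, blockWeight T TL t u v w a q.2.1 i (q.2.2 i) := by
    rw [sum_sigma]
    refine sum_congr rfl fun m _ => ?_
    rw [sum_biUnion]
    · refine sum_congr rfl fun ρ _ => ?_
      rw [sum_image]
      rintro b - b' - e
      exact (Prod.mk.inj e).2
    · rintro ρ - ρ' - hne
      refine disjoint_left.2 fun x h1 h2 => hne ?_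
      obtain ⟨b, -, rfl⟩ := mem_image.1 h1
      obtain ⟨b', -, e⟩ := mem_image.1 h2
      exact (Prod.mk.inj e).1.symm
  rw [hsum]
  symm
  refine sum_bij (fun q hq => ((hS q).1 hq).1.exists_inflation.choose) ?_ ?_ ?_ ?_
  · intro q hq
    obtain ⟨h1, h2⟩ := ((hS q).1 hq).1.exists_inflation.choose_spec
    rw [mem_filter, mem_markedPerms, ← h2.size]
    exact ⟨⟨((hS q).1 hq).2, h1.marked⟩, h1.inv⟩
  · intro q hq r hr e
    have h1 := ((hS q).1 hq).1.exists_inflation.choose_spec.2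
    have h2 := ((hS r).1 hr).1.exists_inflation.choose_spec.2
    rw [← e] at h2
    exact h1.eq_left ((hS q).1 hq).1 ((hS r).1 hr).1 h2
  · intro P hP
    rw [mem_filter, mem_markedPerms] at hP
    obtain ⟨q, h1, h2⟩ := MarkedPerm.IsInv.exists_skeleton ⟨hP.2, hP.1.2⟩
    refine ⟨q, (hS q).2 ⟨h1, h2.size.trans hP.1.1⟩, ?_⟩
    exact IsInflation.eq_right h1 h1.exists_inflation.choose_spec.2 h2
  · intro q hq
    have h1 := ((hS q).1 hq).1
    exact (h1.exists_inflation.choose_spec.2.invWeight_eq_prod h1 t u v w a ha).symm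

end

/-! ### Orbit representatives -/

section

variable {R : Type*} [CommRing R] {T TL : Set HPattern}

/-- The blocks allowed at position `i` of an inflation of `ρ`, with only the smaller element of each
2-cycle carrying a block. -/
noncomputable def blockChoices (T : Set HPattern) (n : ℕ) {m : ℕ} (ρ : Equiv.Perm (Fin m))
    (i : Fin m) : Finset MarkedPerm :=
  if ρ i = i then (indecomposables T n).filter fun P => P.inv = P
  else if i < ρ i then indecomposables T n else {point}

/-- The contribution to the length of the block `B` at position `i`, the blocks of a 2-cycle
being accounted for at its smaller element. -/
noncomputable def blockDegree {m : ℕ} (ρ : Equiv.Perm (Fin m)) (i : Fin m) (B : MarkedPerm) : ℕ :=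
  if ρ i = i then B.size else if i < ρ i then B.size + B.size else 0

theorem apply_apply_of_inv_eq {α : Type*} {ρ : Equiv.Perm α} (hρ : ρ⁻¹ = ρ) (i : α) :
    ρ (ρ i) = i := by
  have := Equiv.symm_apply_apply ρ i
  rwa [← Equiv.Perm.inv_def, hρ] at this

theorem lt_apply_apply_iff {m : ℕ} {ρ : Equiv.Perm (Fin m)} (hρ : ρ⁻¹ = ρ) (i : Fin m)
    (hi : ρ i ≠ i) : ρ i < ρ (ρ i) ↔ ¬ i < ρ i := by
  rw [apply_apply_of_inv_eq hρ, not_lt]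
  exact ⟨le_of_lt, fun h => h.lt_of_ne hi⟩

/-- A symmetric family of blocks is determined by its members at the fixed points and at the smaller
elements of the 2-cycles of `ρ`, which are arbitrary. -/
theorem sum_symmetricFamilies (hT : IsSelfInverse T) (n : ℕ) {m : ℕ} {ρ : Equiv.Perm (Fin m)}
    (hρ : ρ⁻¹ = ρ) (t : R) (u v w a : HPattern → R) :
    ∑ b ∈ symmetricFamilies T n ρ, ∏ i, blockWeight T TL t u v w a ρ i (b i) =
      ∑ b ∈ Fintype.piFinset (blockChoices T n ρ) with ∑ i, blockDegree ρ i (b i) = n,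
        ∏ i, blockWeight T TL t u v w a ρ i (b i) := by
  have hρρ := apply_apply_of_inv_eq hρ
  have hdeg : ∀ b : Fin m → MarkedPerm, (∀ i, b (ρ i) = (b i).inv) →
      ∑ i, (b i).size = ∑ i, blockDegree ρ i (b i) := by
    intro b hb
    rw [sum_eq_sum_orbits hρρ (fun _ _ => mem_univ _) (fun i => i < ρ i)
      (lt_apply_apply_iff hρ)]
    refine sum_congr rfl fun i _ => ?_
    rw [blockDegree, hb]
    rfl
  let res : (Fin m → MarkedPerm) → Fin m → MarkedPerm := fun b i =>
    if ρ i = i ∨ i < ρ i then b i else point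
  let sym : (Fin m → MarkedPerm) → Fin m → MarkedPerm := fun b i =>
    if ρ i = i ∨ i < ρ i then b i else (b (ρ i)).inv
  have hresdeg : ∀ b i, blockDegree ρ i (res b i) = blockDegree ρ i (b i) := by
    intro b i
    by_cases h1 : ρ i = i <;> by_cases h2 : i < ρ i <;> simp [blockDegree, res, h1, h2]
  have hsymdeg : ∀ b i, blockDegree ρ i (sym b i) = blockDegree ρ i (b i) := by
    intro b i
    by_cases h1 : ρ i = i <;> by_cases h2 : i < ρ i <;> simp [blockDegree, sym, h1, h2]
  have hsymsym : ∀ b ∈ Fintype.piFinset (blockChoices T n ρ), ∀ i,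
      sym b (ρ i) = (sym b i).inv := by
    intro b hb i
    have hbi := Fintype.mem_piFinset.1 hb i
    by_cases h1 : ρ i = i
    · rw [blockChoices, if_pos h1, mem_filter] at hbi
      simp only [sym, h1, true_or, if_true]
      exact hbi.2.symm
    · have h1' : ¬ i = ρ i := fun e => h1 e.symm
      have h2 := lt_apply_apply_iff hρ i h1
      rw [hρρ] at h2
      by_cases h3 : i < ρ i
      · have h4 : ¬ ρ i < i := fun h => h2.1 h h3
        simp [sym, hρρ, h1, h1', h3, h4]
      · have h4 := h2.2 h3
        simp [sym, hρρ, h1, h1', h3, h4, MarkedPerm.inv_inv]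
  refine sum_nbij' res sym ?_ ?_ ?_ ?_ ?_
  · intro b hb
    rw [mem_symmetricFamilies] at hb
    obtain ⟨h1, h2, h3⟩ := hb
    rw [mem_filter, Fintype.mem_piFinset]
    refine ⟨fun i => ?_, ?_⟩
    · have hmem : b i ∈ indecomposables T n := mem_indecomposables.2 ⟨h1 i, by
        rw [← h3]
        exact single_le_sum (f := fun i => (b i).size) (fun _ _ => Nat.zero_le _) (mem_univ i)⟩
      by_cases hi : ρ i = i
      · have := h2 i
        rw [hi] at this
        simp [blockChoices, res, hi, hmem, ← this]
      · by_cases hi' : i < ρ i <;> simp [blockChoices, res, hi, hi', hmem]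
    · simp only [hresdeg]
      rw [← hdeg b h2, h3]
  · intro b hb
    rw [mem_filter] at hb
    have hsb := hsymsym b hb.1
    have hbi := fun i => Fintype.mem_piFinset.1 hb.1 i
    rw [mem_symmetricFamilies]
    have hind : ∀ i, (ρ i = i ∨ i < ρ i) → (b i).Indecomposable T := by
      intro i hi
      have := hbi i
      rw [blockChoices] at this
      split_ifs at this
      · exact (mem_indecomposables.1 (mem_filter.1 this).1).1
      · exact (mem_indecomposables.1 this).1
      · tauto
    refine ⟨fun i => ?_, hsb, ?_⟩
    · simp only [sym]
      split_ifs with hi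
      · exact hind i hi
      · refine (hind (ρ i) (.inr ?_)).inv hT
        rw [not_or] at hi
        exact (lt_apply_apply_iff hρ i hi.1).2 hi.2
    · rw [hdeg _ hsb]
      simp only [hsymdeg]
      exact hb.2
  · intro b hb
    rw [mem_symmetricFamilies] at hb
    funext i
    simp only [sym, res]
    split_ifs with h1 h2
    · rfl
    · rw [hb.2.1, MarkedPerm.inv_inv]
    · rw [not_or] at h1
      exact absurd (Or.inr ((lt_apply_apply_iff hρ i h1.1).2 h1.2)) h2
  · intro b hb
    rw [mem_filter] at hb
    funext i
    have hbi := Fintype.mem_piFinset.1 hb.1 i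
    rw [blockChoices] at hbi
    simp only [sym, res]
    split_ifs at hbi ⊢ <;> first | rfl | tauto | exact (mem_singleton.1 hbi).symm
  · intro b _
    refine prod_congr rfl fun i _ => ?_
    by_cases h1 : ρ i = i <;> by_cases h2 : i < ρ i <;> simp [blockWeight, res, h1, h2]

/-! ### Coefficients of the generating functions -/

open PowerSeries in
/-- `F_T` counts the `T`-marked involutions, with the weights reduced by one. -/
theorem coeff_patternGF (hinv : IsSelfInverse T) (hTL : IsHalf T TL) (t : R)
    (u ubar w s : HPattern → R) (hs : ∀ τ ∈ involutive T, s τ ^ 2 = ubar τ ^ 2 - 1) (n : ℕ) :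
    coeff n (patternGF T TL t u ubar w) = ∑ P ∈ markedPerms T n with P.inv = P,
      P.invWeight T TL t (fun τ => u τ - 1) s (fun τ => w τ - 1) := by
  rw [sum_markedPerms, patternGF, coeff_mk, sum_filter]
  refine sum_congr rfl fun π _ => ?_
  have hcond : ∀ M : Finset Occ, MarkedPerm.inv ⟨n, π, M⟩ = ⟨n, π, M⟩ ↔
      π⁻¹ = π ∧ M.image sibling = M := by
    intro M
    simp [MarkedPerm.inv]
  simp only [hcond]
  split_ifs with hπ
  · simp only [hπ, true_and]
    rw [← MarkedPerm.invWeight_occurrences hinv hTL hπ t u ubar s w hs]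
    exact MarkedPerm.Marked.invWeight_eq (P := ⟨n, π, occurrences T π⟩)
      (MarkedPerm.marked_iff.2 (Subset.refl _)) t u ubar w
  · simp [hπ]

theorem eq_point {P : MarkedPerm} (h : P.Indecomposable T) (h1 : P.size = 1) : P = point := by
  have h2 := (MarkedPerm.indecomposable_iff_of_size_eq_one h1).1 h
  obtain ⟨n, π, M⟩ := P
  obtain rfl : n = 1 := h1
  obtain rfl : M = ∅ := h2
  rw [Subsingleton.elim π 1]
  rfl

theorem markedPerms_one (p : MarkedPerm → Prop) [DecidablePred p]
    (hp : ∀ P, p P → P.Indecomposable T) (h : p point) : (markedPerms T 1).filter p = {point} := by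
  ext P
  rw [mem_filter, mem_markedPerms, mem_singleton]
  constructor
  · rintro ⟨⟨h1, -⟩, h2⟩
    exact eq_point (hp P h2) h1
  · rintro rfl
    exact ⟨⟨rfl, (point_indecomposable T).marked⟩, h⟩

theorem markedPerms_zero (p : MarkedPerm → Prop) [DecidablePred p]
    (hp : ∀ P, p P → P.Indecomposable T) : (markedPerms T 0).filter p = ∅ := by
  refine filter_false_of_mem fun P hP h => ?_
  have := (hp P h).pos
  rw [(mem_markedPerms.1 hP).1] at this
  omega

theorem invWeight_point (t : R) (u v w : HPattern → R) : point.invWeight T TL t u v w = t := by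
  change (∏ x ∈ range 1, if extend (1 : Equiv.Perm (Fin 1)) x = x then t else 1) *
    ∏ o ∈ (∅ : Finset Occ), _ = t
  rw [prod_range_one, prod_empty, mul_one]
  exact if_pos rfl

theorem clusterWeight_point (a b c : HPattern → R) : point.clusterWeight T TL a b c = 1 :=
  prod_empty

open PowerSeries in
/-- The series substituted for fixed points counts the indecomposable marked involutions. -/
theorem coeff_fixed_block (t : R) (u v w : HPattern → R) (k : ℕ) :
    coeff k (X * C t + involutoryClusterGF T TL t u v w) =
      ∑ P ∈ markedPerms T k with P.Indecomposable T ∧ P.inv = P, P.invWeight T TL t u v w := by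
  rw [map_add, X_mul, coeff_C_mul, coeff_X, involutoryClusterGF, coeff_mk]
  have hsmall : k < 2 → ∑ π : Equiv.Perm (Fin k), ∑ M ∈ (occurrences T π).powerset with
      IsInvolutoryCluster T π M, t ^ fp π *
      (∏ᶠ τ ∈ involutive T, u τ ^ sibCount τ π M) *
      (∏ᶠ τ ∈ involutive T, v τ ^ nsibCount τ π M) *
      (∏ᶠ σ ∈ TL, w σ ^ occCount σ π M) = 0 := by
    intro hk
    refine sum_eq_zero fun π _ => ?_
    rw [filter_false_of_mem, sum_empty]
    rintro M - ⟨⟨h, -⟩, -⟩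
    omega
  obtain rfl | rfl | hk : k = 0 ∨ k = 1 ∨ 2 ≤ k := by omega
  · rw [hsmall (by omega), markedPerms_zero _ fun P h => h.1]; simp
  · rw [hsmall (by omega), markedPerms_one _ (fun P h => h.1) ⟨point_indecomposable T, point_inv⟩,
      sum_singleton, invWeight_point]
    simp
  · rw [if_neg (by omega), mul_zero, zero_add, sum_markedPerms]
    refine sum_congr rfl fun π _ => ?_
    have hcond : ∀ M ∈ (occurrences T π).powerset, (IsInvolutoryCluster T π M ↔
        MarkedPerm.Indecomposable T ⟨k, π, M⟩ ∧ MarkedPerm.inv ⟨k, π, M⟩ = ⟨k, π, M⟩) := by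
      intro M hM
      rw [MarkedPerm.indecomposable_iff_isCluster (P := ⟨k, π, M⟩) hk, IsInvolutoryCluster]
      refine and_congr_right fun _ => ?_
      have h1 : MarkedPerm.inv ⟨k, π, M⟩ = ⟨k, π, M⟩ ↔ π⁻¹ = π ∧ M.image sibling = M := by
        simp [MarkedPerm.inv]
      rw [h1, IsMarkedInvolution]
      refine and_congr_right fun _ => ?_
      rw [and_iff_right (show IsMarked T π M from mem_powerset.1 hM)]
      constructor
      · intro h
        ext o
        rw [mem_image_sibling]
        exact ⟨h o, fun ho => h (sibling o) ho⟩
      · intro h o ho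
        rw [← h, mem_image_sibling]
        exact ho
    rw [filter_congr hcond]
    refine sum_congr rfl fun M hM => ?_
    rw [mem_filter] at hM
    exact hM.2.1.marked.invWeight_eq t u v w

open PowerSeries in
/-- The series substituted for 2-cycles counts, before `x ↦ x ^ 2`, the indecomposable marked
permutations. -/
theorem coeff_moved_block (a b c : HPattern → R) (k : ℕ) :
    coeff k (X + clusterGF T TL a b c) =
      ∑ P ∈ markedPerms T k with P.Indecomposable T, P.clusterWeight T TL a b c := by
  rw [map_add, coeff_X, clusterGF, coeff_mk]
  have hsmall : k < 2 → ∑ π : Equiv.Perm (Fin k), ∑ M ∈ (occurrences T π).powerset with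
      IsCluster T π M, (∏ᶠ τ ∈ involutive T, a τ ^ occCount τ π M) *
      (∏ᶠ σ ∈ TL, b σ ^ occCount σ π M) *
      (∏ᶠ σ ∈ TL, c σ ^ occCount σ.inv π M) = 0 := by
    intro hk
    refine sum_eq_zero fun π _ => ?_
    rw [filter_false_of_mem, sum_empty]
    rintro M - ⟨h, -⟩
    omega
  obtain rfl | rfl | hk : k = 0 ∨ k = 1 ∨ 2 ≤ k := by omega
  · rw [hsmall (by omega), markedPerms_zero _ fun P h => h]; simp
  · rw [hsmall (by omega), markedPerms_one _ (fun P h => h) (point_indecomposable T),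
      sum_singleton, clusterWeight_point]
    simp
  · rw [if_neg (by omega), zero_add, sum_markedPerms]
    refine sum_congr rfl fun π _ => ?_
    have hcond : ∀ M ∈ (occurrences T π).powerset, (IsCluster T π M ↔
        MarkedPerm.Indecomposable T ⟨k, π, M⟩) := fun M _ =>
      (MarkedPerm.indecomposable_iff_isCluster (P := ⟨k, π, M⟩) hk).symm
    rw [filter_congr hcond]
    refine sum_congr rfl fun M hM => ?_
    rw [mem_filter] at hM
    exact hM.2.marked.clusterWeight_eq a b c

end

/-! ### The composition with the generating function of involutions -/

section

variable {R : Type*} [CommRing R] {T TL : Set HPattern}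

/-- Each 2-cycle of an involution has one element that is mapped to a larger one. -/
theorem card_lt_apply {m : ℕ} {ρ : Equiv.Perm (Fin m)} (hρ : ρ⁻¹ = ρ) :
    #{i | ρ i ≠ i ∧ i < ρ i} = cyc ρ := by
  have h1 := fp_add_two_mul_cyc ρ hρ
  have h2 : ∑ i : Fin m, 1 =
      ∑ i : Fin m, if ρ i = i then 1 else if i < ρ i then 1 + 1 else 0 :=
    sum_eq_sum_orbits (apply_apply_of_inv_eq hρ) (fun _ _ => mem_univ _) (fun i => i < ρ i)
      (lt_apply_apply_iff hρ) fun _ => 1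
  have h3 : (∑ i : Fin m, if ρ i = i then 1 else if i < ρ i then 1 + 1 else 0) =
      (∑ i : Fin m, if ρ i = i then 1 else 0) +
        2 * ∑ i : Fin m, if ρ i ≠ i ∧ i < ρ i then 1 else 0 := by
    rw [mul_sum, ← sum_add_distrib]
    refine sum_congr rfl fun i _ => ?_
    by_cases h : ρ i = i <;> by_cases h' : i < ρ i <;> simp [h, h']
  rw [h3, ← card_filter, ← card_filter] at h2
  simp only [sum_const, card_univ, Fintype.card_fin, smul_eq_mul, mul_one] at h2
  unfold fp at h1
  omega

open PowerSeries

theorem pow_mul_pow_eq_prod {m : ℕ} {ρ : Equiv.Perm (Fin m)} (hρ : ρ⁻¹ = ρ) (A B : PowerSeries R) :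
    A ^ fp ρ * B ^ cyc ρ = ∏ i, if ρ i = i then A else if i < ρ i then B else 1 := by
  rw [← card_lt_apply hρ, fp, ← prod_const, ← prod_const, prod_filter, prod_filter,
    ← prod_mul_distrib]
  refine prod_congr rfl fun i _ => ?_
  by_cases h : ρ i = i <;> by_cases h' : i < ρ i <;> simp [h, h']

/-- The composite with the generating function of involutions as a sum over involutions. Only
those of length at most `n` contribute to the coefficient of `x ^ n`. -/
theorem coeff_involutionGFAt {A B : PowerSeries R} (hA : X ∣ A) (hB : X ^ 2 ∣ B) (n : ℕ) :
    coeff n (involutionGFAt A B) = ∑ m ∈ range (n + 1), ∑ ρ : Equiv.Perm (Fin m) with ρ⁻¹ = ρ,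
      coeff n (A ^ fp ρ * B ^ cyc ρ) := by
  have hsubst := hasSubst_pair A B (X_dvd_iff.1 hA)
    (X_dvd_iff.1 ((dvd_pow_self X two_ne_zero).trans hB))
  let D : Finset (ℕ × ℕ) :=
    (range (n + 1) ×ˢ range (n + 1)).filter fun p => p.1 + 2 * p.2 ∈ range (n + 1)
  have hD : ∀ p, p ∈ D ↔ p.1 + 2 * p.2 ≤ n := by
    intro p
    simp only [D, mem_filter, mem_product, mem_range]
    omega
  let e : (Fin 2 →₀ ℕ) ≃ ℕ × ℕ := Finsupp.equivFunOnFinite.trans (finTwoArrowEquiv ℕ)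
  let num : ℕ × ℕ → ℕ := fun p =>
    #{π : Equiv.Perm (Fin (p.1 + 2 * p.2)) | π⁻¹ = π ∧ fp π = p.1 ∧ cyc π = p.2}
  have h1 : coeff n (involutionGFAt A B) =
      ∑ᶠ p : ℕ × ℕ, (num p : R) * coeff n (A ^ p.1 * B ^ p.2) := by
    rw [← finsum_comp_equiv e]
    refine (MvPowerSeries.coeff_subst hsubst _ _).trans ?_
    refine finsum_congr fun d => ?_
    rw [Finsupp.prod_fintype _ _ (by simp), Fin.prod_univ_two, smul_eq_mul]
    rfl
  have hzero : ∀ p ∉ D, coeff n (A ^ p.1 * B ^ p.2) = 0 := by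
    intro p hp
    rw [hD] at hp
    have hdvd : X ^ (p.1 + 2 * p.2) ∣ A ^ p.1 * B ^ p.2 := by
      rw [pow_add, pow_mul]
      exact mul_dvd_mul (pow_dvd_pow_of_dvd hA _) (pow_dvd_pow_of_dvd hB _)
    exact X_pow_dvd_iff.1 hdvd n (by omega)
  rw [h1, finsum_eq_sum_of_support_subset (s := D)]
  · rw [← sum_fiberwise_of_maps_to (s := D) (t := range (n + 1)) (g := fun p => p.1 + 2 * p.2)
      fun p hp => (mem_filter.1 hp).2]
    refine sum_congr rfl fun m hm => ?_
    rw [← sum_fiberwise_of_maps_to (s := univ.filter fun ρ : Equiv.Perm (Fin m) => ρ⁻¹ = ρ)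
      (t := D.filter fun p => p.1 + 2 * p.2 = m) (g := fun ρ => (fp ρ, cyc ρ))]
    · refine sum_congr rfl fun p hp => ?_
      obtain ⟨-, rfl⟩ := mem_filter.1 hp
      rw [filter_filter, ← nsmul_eq_mul, ← sum_const]
      refine sum_congr (filter_congr fun ρ _ => ?_) fun ρ hρ => ?_
      · rw [Prod.ext_iff]
      · have h := (mem_filter.1 hρ).2.2
        rw [show fp ρ = p.1 from congrArg Prod.fst h, show cyc ρ = p.2 from congrArg Prod.snd h]
    · intro ρ hρ
      have := fp_add_two_mul_cyc ρ (mem_filter.1 hρ).2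
      rw [mem_filter, hD]
      rw [mem_range] at hm
      exact ⟨by simp only; omega, this⟩
  · intro p hp
    by_contra h
    exact hp (mul_eq_zero_of_right _ (hzero p h))

theorem coeff_prod_congr {ι : Type*} {s : Finset ι} {f g : ι → PowerSeries R} {n : ℕ}
    (h : ∀ i ∈ s, ∀ k ≤ n, coeff k (f i) = coeff k (g i)) :
    coeff n (∏ i ∈ s, f i) = coeff n (∏ i ∈ s, g i) := by
  rw [coeff_prod, coeff_prod]
  refine sum_congr rfl fun l hl => prod_congr rfl fun i hi => h i hi _ ?_
  rw [mem_finsuppAntidiag] at hl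
  rw [← hl.1]
  exact single_le_sum (f := l) (fun _ _ => Nat.zero_le _) hi

theorem coeff_prod_sum {m : ℕ} (S : Fin m → Finset MarkedPerm) (W : Fin m → MarkedPerm → R)
    (d : Fin m → MarkedPerm → ℕ) (n : ℕ) :
    coeff n (∏ i, ∑ P ∈ S i, C (W i P) * X ^ d i P) =
      ∑ b ∈ Fintype.piFinset S with ∑ i, d i (b i) = n, ∏ i, W i (b i) := by
  rw [prod_univ_sum, map_sum, sum_filter]
  refine sum_congr rfl fun b _ => ?_
  rw [prod_mul_distrib, prod_pow_eq_pow_sum, ← map_prod, coeff_C_mul_X_pow]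
  simp only [eq_comm]

theorem coeff_sum_indecomposables (p : MarkedPerm → Prop) [DecidablePred p]
    (W : MarkedPerm → R) {n k : ℕ}
    (hk : k ≤ n) : coeff k (∑ P ∈ indecomposables T n with p P, C (W P) * X ^ P.size) =
      ∑ P ∈ markedPerms T k with P.Indecomposable T ∧ p P, W P := by
  rw [map_sum]
  simp only [coeff_C_mul_X_pow]
  rw [← sum_filter]
  refine sum_congr ?_ fun _ _ => rfl
  ext P
  simp only [mem_filter, mem_indecomposables, mem_markedPerms]
  constructor
  · rintro ⟨⟨⟨h1, -⟩, h2⟩, rfl⟩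
    exact ⟨⟨rfl, h1.marked⟩, h1, h2⟩
  · rintro ⟨⟨rfl, -⟩, h1, h2⟩
    exact ⟨⟨⟨h1, hk⟩, h2⟩, rfl⟩

theorem coeff_sum_indecomposables_sq (W : MarkedPerm → R) (f : PowerSeries R)
    (hf : ∀ k, coeff k f = ∑ P ∈ markedPerms T k with P.Indecomposable T, W P) {n k : ℕ}
    (hk : k ≤ n) : coeff k (atXSq f) =
      coeff k (∑ P ∈ indecomposables T n, C (W P) * X ^ (P.size + P.size)) := by
  rw [atXSq, coeff_subst_X_pow two_ne_zero, map_sum]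
  simp only [coeff_C_mul_X_pow]
  rw [← sum_filter]
  split_ifs with h
  · obtain ⟨j, rfl⟩ := h
    rw [Nat.mul_div_cancel_left _ two_pos, hf]
    refine sum_congr ?_ fun _ _ => rfl
    ext P
    simp only [mem_filter, mem_indecomposables, mem_markedPerms]
    constructor
    · rintro ⟨⟨h1, -⟩, h2⟩
      exact ⟨⟨h2, by omega⟩, by omega⟩
    · rintro ⟨⟨h1, -⟩, h2⟩
      exact ⟨⟨by omega, h1.marked⟩, h1⟩
  · symm
    refine sum_eq_zero fun P hP => absurd ?_ h
    exact ⟨P.size, by have := (mem_filter.1 hP).2; omega⟩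

theorem X_sq_add_atXSq (f : PowerSeries R) : X ^ 2 + atXSq f = atXSq (X + f) := by
  rw [atXSq, atXSq, subst_add (HasSubst.X_pow two_ne_zero), subst_X (HasSubst.X_pow two_ne_zero)]

theorem X_sq_dvd_atXSq {f : PowerSeries R} (hf : constantCoeff f = 0) : X ^ 2 ∣ atXSq f := by
  rw [X_pow_dvd_iff]
  intro k hk
  rw [atXSq, coeff_subst_X_pow two_ne_zero]
  split_ifs with h
  · obtain rfl : k = 0 := by omega
    simpa using hf
  · rfl

end

end Hertzsprung

open Hertzsprung in
theorem theorem3p2 {R : Type*} [CommRing R] (T TL : Set Hertzsprung.HPattern)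
    (hsimple : Hertzsprung.IsSimple T) (hinv : Hertzsprung.IsSelfInverse T)
    (hTL : Hertzsprung.IsHalf T TL)
    (t : R) (u ubar w : Hertzsprung.HPattern → R)
    (s : Hertzsprung.HPattern → R)
    (hs : ∀ τ ∈ Hertzsprung.involutive T, s τ ^ 2 = ubar τ ^ 2 - 1) :
    Hertzsprung.patternGF T TL t u ubar w =
      Hertzsprung.involutionGFAt
        (PowerSeries.X * PowerSeries.C t +
          Hertzsprung.involutoryClusterGF T TL t (fun τ => u τ - 1) s (fun σ => w σ - 1))
        (PowerSeries.X ^ 2 +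
          Hertzsprung.atXSq (Hertzsprung.clusterGF T TL (fun τ => ubar τ ^ 2 - 1)
            (fun σ => w σ - 1) (fun σ => w σ - 1))) := by
  ext n
  rw [coeff_patternGF hinv hTL t u ubar w s hs, sum_isInv T TL n t _ s _ _ hs, X_sq_add_atXSq,
    coeff_involutionGFAt]
  · refine sum_congr rfl fun m _ => sum_congr rfl fun ρ hρ => ?_
    have hρ := (mem_filter.1 hρ).2
    rw [sum_symmetricFamilies hinv n hρ, ← coeff_prod_sum, pow_mul_pow_eq_prod hρ]
    refine coeff_prod_congr fun i _ k hk => ?_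
    simp only [blockChoices, blockWeight, blockDegree]
    split_ifs
    · rw [coeff_sum_indecomposables _ _ hk, coeff_fixed_block]
    · exact (coeff_sum_indecomposables_sq _ _ (coeff_moved_block _ _ _) hk).symm
    · simp
  · rw [PowerSeries.X_dvd_iff, map_add, constantCoeff_involutoryClusterGF]
    simp
  · refine X_sq_dvd_atXSq ?_
    rw [map_add, constantCoeff_clusterGF]
    simp
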